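/- Let $F$ be a nonarchimedean local field with ring of integers $\mathfrak o_F$, let $N\ge 1$, $G=\mathrm{GL}(N,F)$, and $G^o=\{g\in G : \det g\in\mathfrak o_F^\times\}$. Let $X$ be the Bruhat–Tits building of $G$, $T$ a maximal split torus of $G$, and $\mathcal A$ the apartment of $X$ attached to $T$. The Iwahori subgroup attached to a chamber $C$ of $X$ is $\{g\in G^o : gC=C\}$, and for a union $\Omega$ of simplices of $\mathcal A$ the enclos of $\Omega$ is the intersection of the half-apartments of $\mathcal A$ (defined by affine roots) that contain $\Omega$. Fix a Haar measure on $G$; let $\mathcal H(G)$ be the convolution algebra of locally constant compactly supported functions $G\to\mathbb C$, acting on every smooth complex representation of $G$, and for an Iwahori subgroup $K$ let $e_K=\mathrm{vol}(K)^{-1}\mathbf 1_K\in\mathcal H(G)$. Let $I$ and $J$ be the Iwahori subgroups attached to chambers $C_I$ and $C_J$ of $\mathcal A$, and let $\mathcal W$ be a smooth complex representation of $G$. 1. The map $\mathcal W^J\to\mathcal W^I$, $v\mapsto e_I\cdot v$, is an isomorphism of complex vector spaces. 2. If $K$ is the Iwahori subgroup attached to a chamber $C_K$ contained in the enclos of $C_J\cup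 C_I$, then the map in (1) is the composite of the linear maps $\mathcal W^J\to\mathcal W^K$, $v\mapsto e_K\cdot v$, and $\mathcal W^K\to\mathcal W^I$, $w\mapsto e_I\cdot w$. 3. If $C_I$ and $C_J$ are adjacent, then there are $f,g\in\mathcal H(G)$ with $e_J=f\star e_I\star e_J$ and $e_I=e_I\star e_J\star g$. -/

import Mathlib

open MeasureTheory ValuativeRel
open scoped Matrix MatrixGroups

noncomputable section

namespace IwahoriGL

/-! ### The building of `GL(N, F)` through lattice chains

`F` is a nonarchimedean local field with ring of integers `𝒪[F]`; the group `GL(N, F)` acts on the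
column space `F ^ N`. A simplex of the building is a nonempty chain of lattices, closed under
homotheties; its vertices are the homothety classes of lattices in it, and its faces are the
nonempty homothety-closed subsets. -/

section Building

variable {F : Type*} [Field F] [ValuativeRel F] {N : ℕ}

/-- The image `g L` of an `𝒪[F]`-submodule `L` of `F ^ N`. -/
def latticeAct (g : GL (Fin N) F) (L : Submodule 𝒪[F] (Fin N → F)) :
    Submodule 𝒪[F] (Fin N → F) :=
  L.map ((Matrix.mulVecLin (g : Matrix (Fin N) (Fin N) F)).restrictScalars 𝒪[F])

/-- The homothetic submodule `c L`. -/
def homothety (c : Fˣ) (L : Submodule 𝒪[F] (Fin N → F)) : Submodule 𝒪[F] (Fin N → F) :=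
  L.map ((LinearMap.lsmul F (Fin N → F) (c : F)).restrictScalars 𝒪[F])

/-- The homothety class of `L`: a vertex of the building when `L` is a lattice. -/
def homothetyClass (L : Submodule 𝒪[F] (Fin N → F)) : Set (Submodule 𝒪[F] (Fin N → F)) :=
  Set.range fun c : Fˣ => homothety c L

/-- Simplices of the building: nonempty chains of lattices that are closed under homotheties. -/
structure IsSimplex (C : Set (Submodule 𝒪[F] (Fin N → F))) : Prop where
  nonempty : C.Nonempty
  isLattice : ∀ L ∈ C, Submodule.IsLattice F L
  homothety_mem : ∀ L ∈ C, ∀ c : Fˣ, homothety c L ∈ C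
  isChain : IsChain (· ≤ ·) C

/-- Chambers: maximal simplices. -/
def IsChamber (C : Set (Submodule 𝒪[F] (Fin N → F))) : Prop :=
  Maximal IsSimplex C

/-- Two chambers are adjacent if they are distinct and share a face of codimension one: each of
them has exactly one vertex that does not belong to the other. -/
def Adjacent (C D : Set (Submodule 𝒪[F] (Fin N → F))) : Prop :=
  (∃ L ∈ C, C \ D = homothetyClass L) ∧ ∃ M ∈ D, D \ C = homothetyClass M

/-- The lattice `⨁ i, 𝒪 t_i e_i` attached to a basis `e` of `F ^ N` and to scalars `t_i ≠ 0`. -/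
def frameLattice (e : Module.Basis (Fin N) F (Fin N → F)) (t : Fin N → Fˣ) :
    Submodule 𝒪[F] (Fin N → F) :=
  Submodule.span 𝒪[F] (Set.range fun i => (t i : F) • e i)

/-- The lattices that make up the apartment of the maximal split torus of all `g` that are diagonal
in the basis `e`: a simplex lies in that apartment iff it is a subset of this set. -/
def apartment (e : Module.Basis (Fin N) F (Fin N → F)) : Set (Submodule 𝒪[F] (Fin N → F)) :=
  Set.range (frameLattice e)

/-- A half-apartment. In the coordinates `x_i = ord (t_i)` of `⨁ i, 𝒪 t_i e_i`, it is the locus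
`x_j - x_i + ord c ≥ 0` where an affine root is nonnegative; recall that `a ≤ᵥ b` means
`ord a ≥ ord b`. -/
def halfApartment (e : Module.Basis (Fin N) F (Fin N → F)) (i j : Fin N) (c : Fˣ) :
    Set (Submodule 𝒪[F] (Fin N → F)) :=
  {L | ∃ t : Fin N → Fˣ, L = frameLattice e t ∧ (c : F) * (t j : F) ≤ᵥ (t i : F)}

/-- The enclos of a subset `Ω` of the apartment: the intersection (inside the apartment) of all the
half-apartments that contain `Ω`. -/
def enclos (e : Module.Basis (Fin N) F (Fin N → F)) (Ω : Set (Submodule 𝒪[F] (Fin N → F))) :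
    Set (Submodule 𝒪[F] (Fin N → F)) :=
  {L ∈ apartment e | ∀ i j : Fin N, i ≠ j → ∀ c : Fˣ,
    Ω ⊆ halfApartment e i j c → L ∈ halfApartment e i j c}

theorem latticeAct_one (L : Submodule 𝒪[F] (Fin N → F)) : latticeAct 1 L = L := by
  ext x
  simp [latticeAct]

theorem latticeAct_mul (g h : GL (Fin N) F) (L : Submodule 𝒪[F] (Fin N → F)) :
    latticeAct (g * h) L = latticeAct g (latticeAct h L) := by
  ext x
  simp [latticeAct]

/-- The Iwahori subgroup attached to a chamber `C`: the stabilizer of `C` in the group of all `g`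
whose determinant is a unit of `𝒪[F]`. -/
def iwahori (C : Set (Submodule 𝒪[F] (Fin N → F))) : Subgroup (GL (Fin N) F) where
  carrier := {g | valuation F (Matrix.GeneralLinearGroup.det g : F) = 1 ∧ latticeAct g '' C = C}
  one_mem' := by
    refine ⟨by simp, ?_⟩
    simp [latticeAct_one]
  mul_mem' := by
    rintro g h ⟨hg, hgC⟩ ⟨hh, hhC⟩
    refine ⟨by rw [map_mul, Units.val_mul, map_mul, hg, hh, one_mul], ?_⟩
    conv_rhs => rw [← hgC, ← hhC]
    rw [Set.image_image]
    exact Set.image_congr fun L _ => latticeAct_mul g h L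
  inv_mem' := by
    rintro g ⟨hg, hgC⟩
    refine ⟨by rw [map_inv, Units.val_inv_eq_inv_val, map_inv₀, hg, inv_one], ?_⟩
    conv_lhs => rw [← hgC]
    rw [Set.image_image]
    simp [← latticeAct_mul, latticeAct_one]

end Building

/-! ### Smooth representations and the Hecke algebra -/

section Hecke

variable {G : Type*} [Group G] [TopologicalSpace G]

/-- The complex representation `ρ` is smooth: every vector has an open stabilizer. -/
def IsSmooth {W : Type*} [AddCommGroup W] [Module ℂ W] (ρ : Representation ℂ G W) : Prop :=
  ∀ v : W, IsOpen {g : G | ρ g v = v}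

/-- The subspace of vectors fixed by the subgroup `K`. -/
def fixedVectors {W : Type*} [AddCommGroup W] [Module ℂ W] (ρ : Representation ℂ G W)
    (K : Subgroup G) : Submodule ℂ W where
  carrier := {v | ∀ g ∈ K, ρ g v = v}
  zero_mem' g _ := map_zero _
  add_mem' hv hw g hg := by rw [map_add, hv g hg, hw g hg]
  smul_mem' c v hv g hg := by rw [map_smul, hv g hg]

/-- Membership in the Hecke algebra of `G`: locally constant with compact support. -/
def MemHecke (f : G → ℂ) : Prop :=
  IsLocallyConstant f ∧ HasCompactSupport f

variable [MeasurableSpace G]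

/-- The convolution product of the Hecke algebra, for the Haar measure `μ`. -/
def conv (μ : Measure G) (f g : G → ℂ) : G → ℂ :=
  fun x => ∫ y, f y * g (y⁻¹ * x) ∂μ

/-- The idempotent `e_K` attached to the trivial character of a compact open subgroup `K`:
the indicator function of `K` divided by the volume of `K`. -/
def idem (μ : Measure G) (K : Subgroup G) : G → ℂ :=
  (K : Set G).indicator fun _ => ((μ.real (K : Set G) : ℝ) : ℂ)⁻¹

/-- The integral of a compactly supported locally constant function with values in a complex vector
space, as the finite sum over its nonzero values `w` of `μ (φ = w) • w`. -/
def lcIntegral (μ : Measure G) {W : Type*} [AddCommGroup W] [Module ℂ W] (φ : G → W) : W :=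
  ∑ᶠ w : W, ((μ.real (φ ⁻¹' {w}) : ℝ) : ℂ) • w

/-- The action of the Hecke algebra on a smooth representation: `f · v = ∫ f(g) ρ(g) v dμ(g)`. -/
def heckeAct (μ : Measure G) {W : Type*} [AddCommGroup W] [Module ℂ W]
    (ρ : Representation ℂ G W) (f : G → ℂ) (v : W) : W :=
  lcIntegral μ fun g => f g • ρ g v

end Hecke

end IwahoriGL

end

open IwahoriGL

/-! A chamber of the apartment is encoded by integers `pos i` that are distinct modulo `N`: with `w`
a uniformizer, the vector `w ^ m e i` has position `pos i + m N`, and the lattices of the chamber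
are spanned by the vectors of position at least `k`. The chamber depends only on the ceilings `gap
pos i j` of `(pos j - pos i) / N`. In the basis `e`, its Iwahori subgroup consists of the matrices
with unit determinant whose entry `(i, j)` has order at least `gap pos i j` (`exists_eq_posChain`,
`iwahori_posChain`).

Crossing a wall exchanges two neighbouring positions. A monomial matrix `s` then satisfies `s² ∈ J`,
`I = s J s⁻¹` and `s J s ⊆ J ∪ J s J` (`isReflection_reflGL`). Hence `T = e_J s` on the vectors
fixed by `J` satisfies `T² = c + (1 - c) T`, where `c` is the proportion of `x ∈ J` with `s x s ∈
J`. As this set is open and nonempty, `c ≠ 0` and `T` is invertible; since `e_I = s T` on these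
vectors, `e_I` is bijective (`IsReflection.bijective`). The explicit inverse is the action of an
element of the Hecke algebra. Applied to `e_J` in the left regular representation and to `e_I` in
the right regular one, it gives the identities for adjacent chambers.

For distant chambers, if the chamber of `K` lies between those of `I` and `J`, Gaussian elimination
in a suitable order of the indices gives `K ⊆ I J` (`exists_factorization`), whence `e_I e_K e_J =
e_I e_J`. This is the second assertion, because chambers in the enclos lie between the two given
ones (`min_gap_le_of_subset_enclos`). It also gives the first one by induction along a gallery: if
the chambers differ, some wall of the first separates them, and crossing it decreases the distance
(`exists_isSucc_of_gap_ne`, `IsSucc.gapDist_lt`). -/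

noncomputable section

set_option linter.unusedSectionVars false

namespace IwahoriGL

/-! ### Averaging operators of compact open subgroups -/

section Averaging

variable {G : Type*} [Group G] [TopologicalSpace G]

/-- The subgroup `K` is open and compact. -/
structure IsCompactOpen (K : Subgroup G) : Prop where
  isOpen : IsOpen (K : Set G)
  isCompact : IsCompact (K : Set G)

variable [IsTopologicalGroup G]

theorem IsSmooth.isLocallyConstant {W : Type*} [AddCommGroup W] [Module ℂ W]
    {ρ : Representation ℂ G W} (hρ : IsSmooth ρ) (v : W) :
    IsLocallyConstant fun g => ρ g v := by
  rw [IsLocallyConstant.iff_exists_open]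
  intro g
  refine ⟨(fun x => g⁻¹ * x) ⁻¹' {x | ρ x v = v}, (hρ v).preimage (continuous_const_mul g⁻¹),
    by simp, fun x hx => ?_⟩
  have h : ρ (g⁻¹ * x) v = v := hx
  calc ρ x v = ρ g (ρ (g⁻¹ * x) v) := by rw [← Module.End.mul_apply, ← map_mul]; simp
    _ = ρ g v := by rw [h]

theorem IsCompactOpen.isClosed {K : Subgroup G} (hK : IsCompactOpen K) : IsClosed (K : Set G) :=
  K.isClosed_of_isOpen hK.isOpen

variable [MeasurableSpace G] [BorelSpace G] (μ : Measure G) [μ.IsHaarMeasure]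

theorem IsCompactOpen.measurableSet {K : Subgroup G} (hK : IsCompactOpen K) :
    MeasurableSet (K : Set G) := hK.isOpen.measurableSet

theorem IsCompactOpen.real_pos {K : Subgroup G} (hK : IsCompactOpen K) :
    0 < μ.real (K : Set G) :=
  ENNReal.toReal_pos (hK.isOpen.measure_pos μ ⟨1, K.one_mem⟩).ne' hK.isCompact.measure_lt_top.ne

variable {W : Type*} [AddCommGroup W] [Module ℂ W]

/-- Linear functionals commute with the integral of a locally constant function supported on a
compact set. -/
theorem dual_lcIntegral (φ : G → W) (s : Set G) (hc : IsCompact s)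
    (hφ : IsLocallyConstant φ) (h0 : ∀ g ∉ s, φ g = 0) (l : Module.Dual ℂ W) :
    l (lcIntegral μ φ) = ∫ g, l (φ g) ∂μ := by
  classical
  have hfin : (φ '' s).Finite := by
    have := isCompact_iff_compactSpace.mp hc
    have h := (hφ.comp_continuous (continuous_subtype_val (p := (· ∈ s)))).range_finite
    rwa [Set.range_comp, Subtype.range_coe] at h
  set t : Finset W := hfin.toFinset.erase 0 with ht
  have hsub : ∀ w ∈ t, φ ⁻¹' {w} ⊆ s := by
    intro w hw g hg
    by_contra hgs
    rw [Set.mem_preimage, Set.mem_singleton_iff, h0 g hgs] at hg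
    simp [ht, ← hg] at hw
  have h1 : lcIntegral μ φ = ∑ w ∈ t, ((μ.real (φ ⁻¹' {w}) : ℝ) : ℂ) • w := by
    refine finsum_eq_sum_of_support_subset _ fun w hw => ?_
    have hw0 : w ≠ 0 := by rintro rfl; simp at hw
    have : (φ ⁻¹' {w}).Nonempty := by
      by_contra h
      rw [Set.not_nonempty_iff_eq_empty] at h
      simp [h] at hw
    obtain ⟨g, hg⟩ := this
    have hgs : g ∈ s := by
      by_contra hgs
      exact hw0 (by rw [← Set.mem_singleton_iff.mp hg, h0 g hgs])
    simpa [ht, hw0] using ⟨g, hgs, hg⟩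
  have h2 : (fun g => l (φ g)) = fun g => ∑ w ∈ t, Set.indicator (φ ⁻¹' {w}) (fun _ => l w) g := by
    funext g
    by_cases hg : φ g = 0
    · rw [hg, map_zero, Finset.sum_eq_zero]
      intro w hw
      refine Set.indicator_of_notMem (a := g) (s := φ ⁻¹' {w}) ?_ (fun _ => l w)
      rintro rfl
      simp [ht, hg] at hw
    · rw [Finset.sum_eq_single (φ g)]
      · simp
      · intro w _ hw
        exact Set.indicator_of_notMem (a := g) (s := φ ⁻¹' {w})
          (fun h => hw (Set.mem_singleton_iff.mp h).symm) (fun _ => l w)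
      · intro h
        exfalso
        apply h
        have : g ∈ s := by
          by_contra hgs
          exact hg (h0 g hgs)
        simpa [ht, hg] using ⟨g, this, rfl⟩
  have hm : ∀ w, MeasurableSet (φ ⁻¹' {w}) := fun w => (hφ {w}).measurableSet
  rw [h1, map_sum, h2, integral_finsetSum]
  · refine Finset.sum_congr rfl fun w _ => ?_
    rw [integral_indicator_const _ (hm w), map_smul, Complex.real_smul, smul_eq_mul]
  · intro w hw
    exact (integrable_indicator_iff (hm w)).mpr
      (integrableOn_const ((measure_mono (hsub w hw)).trans_lt hc.measure_lt_top).ne)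

variable {ρ : Representation ℂ G W} {I J K : Subgroup G}

theorem idem_mul_left {k : G} (hk : k ∈ K) (x : G) : idem μ K (k * x) = idem μ K x := by
  by_cases hx : x ∈ K
  · rw [idem, Set.indicator_of_mem (K.mul_mem hk hx), Set.indicator_of_mem hx]
  · rw [idem, Set.indicator_of_notMem (fun h => hx ((K.mul_mem_cancel_left hk).mp h)),
      Set.indicator_of_notMem hx]

theorem idem_mul_right {k : G} (hk : k ∈ K) (x : G) : idem μ K (x * k) = idem μ K x := by
  by_cases hx : x ∈ K
  · rw [idem, Set.indicator_of_mem (K.mul_mem hx hk), Set.indicator_of_mem hx]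
  · rw [idem, Set.indicator_of_notMem (fun h => hx ((K.mul_mem_cancel_right hk).mp h)),
      Set.indicator_of_notMem hx]

theorem idem_inv (x : G) : idem μ K x⁻¹ = idem μ K x := by
  by_cases hx : x ∈ K
  · rw [idem, Set.indicator_of_mem (K.inv_mem hx), Set.indicator_of_mem hx]
  · rw [idem, Set.indicator_of_notMem (fun h => hx (K.inv_mem_iff.mp h)),
      Set.indicator_of_notMem hx]

theorem isLocallyConstant_idem (hK : IsCompactOpen K) : IsLocallyConstant (idem μ K) := by
  rw [IsLocallyConstant.iff_exists_open]
  intro x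
  by_cases hx : x ∈ K
  · exact ⟨K, hK.isOpen, hx, fun y hy => by
      rw [idem, Set.indicator_of_mem hx, Set.indicator_of_mem hy]⟩
  · exact ⟨(K : Set G)ᶜ, hK.isClosed.isOpen_compl, hx, fun y hy => by
      rw [idem, Set.indicator_of_notMem hx, Set.indicator_of_notMem hy]⟩

theorem memHecke_idem (hK : IsCompactOpen K) : MemHecke (idem μ K) :=
  ⟨isLocallyConstant_idem μ hK, HasCompactSupport.intro hK.isCompact fun _ hx =>
    Set.indicator_of_notMem hx _⟩

/-- Integration of a locally constant function against `e_K`. -/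
theorem integral_idem_mul (hK : IsCompactOpen K) (F : G → ℂ) :
    ∫ g, idem μ K g * F g ∂μ = ((μ.real (K : Set G) : ℝ) : ℂ)⁻¹ * ∫ g in K, F g ∂μ := by
  rw [← integral_const_mul, ← integral_indicator hK.measurableSet]
  congr 1
  funext g
  by_cases hg : g ∈ (K : Set G)
  · simp [idem, hg]
  · simp [idem, hg]

/-- Functionals separate the points of a complex vector space, so this formula reduces identities
between vector-valued averages to identities between scalar integrals. -/
theorem dual_heckeAct_idem (hρ : IsSmooth ρ) (hK : IsCompactOpen K) (v : W)
    (l : Module.Dual ℂ W) :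
    l (heckeAct μ ρ (idem μ K) v) = ∫ g, idem μ K g * l (ρ g v) ∂μ := by
  rw [heckeAct, dual_lcIntegral μ _ K hK.isCompact]
  · simp
  · rw [IsLocallyConstant.iff_eventually_eq]
    intro x
    filter_upwards [(isLocallyConstant_idem μ hK).eventually_eq x,
      (hρ.isLocallyConstant v).eventually_eq x] with y h1 h2
    rw [h1, h2]
  · intro g hg
    rw [idem, Set.indicator_of_notMem hg, zero_smul]

theorem integrable_idem_mul (hK : IsCompactOpen K) {F : G → ℂ} (hF : Continuous F) :
    Integrable (fun g => idem μ K g * F g) μ := by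
  refine Continuous.integrable_of_hasCompactSupport
    ((isLocallyConstant_idem μ hK).continuous.mul hF) ?_
  exact (memHecke_idem μ hK).2.mul_right

theorem IsSmooth.continuous_dual (hρ : IsSmooth ρ) (v : W) (l : Module.Dual ℂ W) :
    Continuous fun g => l (ρ g v) :=
  ((hρ.isLocallyConstant v).comp l).continuous

/-- The action of `e_K` on a smooth representation, as a linear map. -/
def heckeProj (hρ : IsSmooth ρ) (hK : IsCompactOpen K) : W →ₗ[ℂ] W where
  toFun v := heckeAct μ ρ (idem μ K) v
  map_add' v w := by
    refine sub_eq_zero.mp ((Module.forall_dual_apply_eq_zero_iff ℂ _).mp fun l => ?_)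
    simp only [map_sub, map_add, dual_heckeAct_idem μ hρ hK]
    rw [← integral_add (integrable_idem_mul μ hK (hρ.continuous_dual v l))
      (integrable_idem_mul μ hK (hρ.continuous_dual w l)), sub_eq_zero]
    simp [mul_add]
  map_smul' c v := by
    refine sub_eq_zero.mp ((Module.forall_dual_apply_eq_zero_iff ℂ _).mp fun l => ?_)
    simp only [map_sub, map_smul, dual_heckeAct_idem μ hρ hK, RingHom.id_apply, smul_eq_mul]
    rw [← integral_const_mul, sub_eq_zero]
    congr 1
    funext g
    ring

variable (hρ : IsSmooth ρ) (hI : IsCompactOpen I) (hJ : IsCompactOpen J) (hK : IsCompactOpen K)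

theorem heckeProj_apply (v : W) : heckeProj μ hρ hK v = heckeAct μ ρ (idem μ K) v := rfl

theorem dual_heckeProj (v : W) (l : Module.Dual ℂ W) :
    l (heckeProj μ hρ hK v) = ∫ g, idem μ K g * l (ρ g v) ∂μ :=
  dual_heckeAct_idem μ hρ hK v l

theorem dual_heckeProj_setIntegral (v : W) (l : Module.Dual ℂ W) :
    l (heckeProj μ hρ hK v) =
      ((μ.real (K : Set G) : ℝ) : ℂ)⁻¹ * ∫ g in K, l (ρ g v) ∂μ := by
  rw [dual_heckeProj, integral_idem_mul μ hK]

/-- A linear map that is constant on the `K`-orbit of `v` takes the same value at `e_K v`. -/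
theorem map_heckeProj_of_forall {W' : Type*} [AddCommGroup W'] [Module ℂ W'] (T : W →ₗ[ℂ] W')
    {v : W} {w : W'} (h : ∀ k ∈ K, T (ρ k v) = w) : T (heckeProj μ hρ hK v) = w := by
  refine sub_eq_zero.mp ((Module.forall_dual_apply_eq_zero_iff ℂ _).mp fun l => ?_)
  have h1 := dual_heckeProj_setIntegral μ hρ hK v (l ∘ₗ T)
  rw [setIntegral_congr_fun (g := fun _ => l w) hK.measurableSet
    (fun k hk => by simp [h k hk]), setIntegral_const, Complex.real_smul, ← mul_assoc,
    inv_mul_cancel₀ (by exact_mod_cast (hK.real_pos μ).ne'), one_mul] at h1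
  rw [map_sub, sub_eq_zero]
  exact h1

theorem heckeProj_of_mem {v : W} (hv : v ∈ fixedVectors ρ K) : heckeProj μ hρ hK v = v :=
  map_heckeProj_of_forall μ hρ hK LinearMap.id hv

theorem heckeProj_mem (v : W) : heckeProj μ hρ hK v ∈ fixedVectors ρ K := by
  intro k hk
  refine sub_eq_zero.mp ((Module.forall_dual_apply_eq_zero_iff ℂ _).mp fun l => ?_)
  rw [map_sub, sub_eq_zero, dual_heckeProj,
    show l (ρ k (heckeProj μ hρ hK v)) = (l ∘ₗ ρ k) (heckeProj μ hρ hK v) from rfl,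
    dual_heckeProj]
  conv_rhs => rw [← integral_mul_left_eq_self _ k]
  congr 1
  funext g
  have h2 : (l ∘ₗ ρ k) (ρ g v) = l (ρ (k * g) v) := by rw [map_mul]; rfl
  rw [idem_mul_left μ hk, h2]

-- Unimodularity is not assumed. Right translation by `k` multiplies the measure of open sets by a
-- constant, and the constant is 1 because `K` is stable under the translation and has finite
-- nonzero measure.
include hK in
theorem measure_preimage_mul_right_of_mem {k : G} (hk : k ∈ K) {s : Set G} (hs : IsOpen s) :
    μ ((· * k) ⁻¹' s) = μ s := by
  have : LocallyCompactSpace G :=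
    hK.isCompact.locallyCompactSpace_of_mem_nhds_of_group (hK.isOpen.mem_nhds K.one_mem)
  have h : ∀ t : Set G, IsOpen t →
      μ ((· * k) ⁻¹' t) = Measure.haarScalarFactor (μ.map (· * k)) μ • μ t := fun t ht => by
    rw [← Measure.measure_isHaarMeasure_eq_smul_of_isOpen (μ.map (· * k)) μ ht,
      Measure.map_apply (measurable_mul_const k) ht.measurableSet]
  have h1 := h K hK.isOpen
  have hpre : (· * k) ⁻¹' (K : Set G) = K := by
    ext x
    exact K.mul_mem_cancel_right hk
  rw [hpre, ENNReal.smul_def, smul_eq_mul] at h1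
  have h2 : (Measure.haarScalarFactor (μ.map (· * k)) μ : ENNReal) = 1 := by
    have hne := (hK.isOpen.measure_pos μ ⟨1, K.one_mem⟩).ne'
    have hfin := hK.isCompact.measure_lt_top (μ := μ).ne
    rwa [eq_comm, ENNReal.mul_eq_right hne hfin] at h1
  rw [h s hs, ENNReal.smul_def, smul_eq_mul, h2, one_mul]

/-- The integrands for `ρ k v` and for `v` differ by right translation by `k`. Their fibres are
open, so corresponding fibres have the same measure. -/
theorem heckeProj_apply_of_mem {k : G} (hk : k ∈ K) (v : W) :
    heckeProj μ hρ hK (ρ k v) = heckeProj μ hρ hK v := by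
  simp only [heckeProj_apply, heckeAct, lcIntegral]
  refine finsum_congr fun w => ?_
  by_cases hw : w = 0
  · simp [hw]
  have hop : IsOpen ((fun g => idem μ K g • ρ g v) ⁻¹' {w}) := by
    refine IsLocallyConstant.isOpen_fiber ?_ w
    rw [IsLocallyConstant.iff_eventually_eq]
    intro x
    filter_upwards [(isLocallyConstant_idem μ hK).eventually_eq x,
      (hρ.isLocallyConstant v).eventually_eq x] with y h1 h2
    rw [h1, h2]
  congr 2
  rw [Measure.real, Measure.real, ← measure_preimage_mul_right_of_mem μ hK hk hop]
  congr 2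
  ext g
  have h2 : ρ g (ρ k v) = ρ (g * k) v := by rw [map_mul]; rfl
  simp only [Set.mem_preimage, idem_mul_right μ hk, h2]

/-- `e_K` is characterized as the `K`-invariant linear projection onto the fixed vectors. -/
theorem heckeProj_unique (T : W →ₗ[ℂ] W) (hT : ∀ k ∈ K, ∀ v, T (ρ k v) = T v)
    (hT' : ∀ v ∈ fixedVectors ρ K, T v = v) (v : W) : heckeProj μ hρ hK v = T v := by
  rw [← hT' _ (heckeProj_mem μ hρ hK v)]
  exact map_heckeProj_of_forall μ hρ hK T fun k hk => hT k hk v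

/-- If `K ⊆ I J`, then `e_I e_K e_J = e_I e_J`. -/
theorem heckeProj_heckeProj_of_factor (hIJ : ∀ k ∈ K, ∃ a ∈ I, ∃ b ∈ J, k = a * b) {v : W}
    (hv : v ∈ fixedVectors ρ J) :
    heckeProj μ hρ hI (heckeProj μ hρ hK v) = heckeProj μ hρ hI v := by
  refine map_heckeProj_of_forall μ hρ hK _ fun k hk => ?_
  obtain ⟨a, ha, b, hb, rfl⟩ := hIJ k hk
  rw [map_mul, Module.End.mul_apply, hv b hb, heckeProj_apply_of_mem μ hρ hI ha]

end Averaging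

/-! ### The quadratic relation and the inverse of `e_I` across a wall -/

section Reflection

variable {G : Type*} [Group G] [TopologicalSpace G] [IsTopologicalGroup G] [MeasurableSpace G]
  [BorelSpace G] (μ : Measure G) [μ.IsHaarMeasure]
  {W : Type*} [AddCommGroup W] [Module ℂ W] {ρ : Representation ℂ G W} {I J : Subgroup G}

/-- The subgroup `I` is the conjugate of `J` under an involution `s` modulo `J` such that
`J ∪ J s J` is stable under multiplication. -/
structure IsReflection (I J : Subgroup G) (s : G) : Prop where
  sq_mem : s * s ∈ J
  mem_iff : ∀ g, g ∈ I ↔ s⁻¹ * g * s ∈ J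
  double_coset : ∀ x ∈ J, s * x * s ∈ J ∨ ∃ a ∈ J, ∃ b ∈ J, s * x * s = a * s * b

/-- The proportion of those `x ∈ J` with `s x s ∈ J`. -/
def returnProb (J : Subgroup G) (s : G) : ℂ :=
  ((μ.real {x | x ∈ J ∧ s * x * s ∈ J} : ℝ) : ℂ) / ((μ.real (J : Set G) : ℝ) : ℂ)

variable {s : G} (hs : IsReflection I J s) (hρ : IsSmooth ρ) (hI : IsCompactOpen I)
  (hJ : IsCompactOpen J)

include hJ in
theorem isOpen_return : IsOpen {x | x ∈ J ∧ s * x * s ∈ J} :=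
  hJ.isOpen.inter (hJ.isOpen.preimage (by fun_prop : Continuous fun x => s * x * s))

-- The set of returning `x` is open and contains `s⁻¹ s⁻¹`, so it has positive measure. This is what
-- makes the quadratic relation invertible.
include hJ hs in
theorem returnProb_ne_zero : returnProb μ J s ≠ 0 := by
  have h : 0 < μ.real {x | x ∈ J ∧ s * x * s ∈ J} := by
    refine ENNReal.toReal_pos ((isOpen_return hJ).measure_pos μ ⟨s⁻¹ * s⁻¹, ?_, ?_⟩).ne'
      ((measure_mono fun x hx => hx.1).trans_lt (hJ.isCompact.measure_lt_top (μ := μ))).ne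
    · simpa using J.inv_mem hs.sq_mem
    · simp
  exact div_ne_zero (by exact_mod_cast h.ne') (by exact_mod_cast (hJ.real_pos μ).ne')

include hs in
theorem IsReflection.inv_apply {v : W} (hv : v ∈ fixedVectors ρ J) : ρ s⁻¹ v = ρ s v := by
  have h : s⁻¹ = s * (s * s)⁻¹ := by group
  rw [h, map_mul, Module.End.mul_apply, hv _ (J.inv_mem hs.sq_mem)]

include hs in
theorem IsReflection.apply_mem_iff {v : W} : ρ s v ∈ fixedVectors ρ I ↔ v ∈ fixedVectors ρ J := by
  constructor
  · intro h k hk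
    have h1 := h (s * k * s⁻¹) ((hs.mem_iff _).mpr (by simpa [mul_assoc] using hk))
    have h2 := congrArg (ρ s⁻¹) h1
    simpa [← Module.End.mul_apply, ← map_mul, mul_assoc] using h2
  · intro h k hk
    have h1 := congrArg (ρ s) (h _ ((hs.mem_iff k).mp hk))
    simpa [← Module.End.mul_apply, ← map_mul, mul_assoc] using h1

include hs in
/-- Transport of structure: `e_I = s e_J s⁻¹`. -/
theorem IsReflection.heckeProj_eq (v : W) :
    heckeProj μ hρ hI v = ρ s (heckeProj μ hρ hJ (ρ s⁻¹ v)) := by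
  refine heckeProj_unique μ hρ hI (ρ s ∘ₗ heckeProj μ hρ hJ ∘ₗ ρ s⁻¹) (fun k hk v => ?_)
    (fun v hv => ?_) v
  · have : ρ s⁻¹ (ρ k v) = ρ (s⁻¹ * k * s) (ρ s⁻¹ v) := by
      simp [← Module.End.mul_apply, ← map_mul, mul_assoc]
    simp only [LinearMap.comp_apply, this]
    rw [heckeProj_apply_of_mem μ hρ hJ ((hs.mem_iff k).mp hk)]
  · have h1 : ρ s (ρ s⁻¹ v) = v := by simp [← Module.End.mul_apply, ← map_mul]
    simp only [LinearMap.comp_apply]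
    rw [heckeProj_of_mem μ hρ hJ (hs.apply_mem_iff.mp (h1.symm ▸ hv)), h1]

include hs in
/-- The quadratic relation for the operator `e_J s` on the vectors fixed by `J`. -/
theorem IsReflection.quadratic {v : W} (hv : v ∈ fixedVectors ρ J) :
    heckeProj μ hρ hJ (ρ s (heckeProj μ hρ hJ (ρ s v))) =
      returnProb μ J s • v + (1 - returnProb μ J s) • heckeProj μ hρ hJ (ρ s v) := by
  set w := heckeProj μ hρ hJ (ρ s v) with hw
  refine sub_eq_zero.mp ((Module.forall_dual_apply_eq_zero_iff ℂ _).mp fun l => ?_)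
  rw [map_sub, sub_eq_zero]
  set A : Set G := {x | x ∈ J ∧ s * x * s ∈ J} with hA
  have hAm : MeasurableSet A := (isOpen_return hJ).measurableSet
  have hAJ : A ⊆ J := fun x hx => hx.1
  have hJfin : μ (J : Set G) ≠ ⊤ := hJ.isCompact.measure_lt_top.ne
  -- Before averaging over `x ∈ J`, the integrand `e_J s x s v` takes two values: `v` when `s x s ∈
  -- J`, and `w` when `s x s ∈ J s J`.
  have hval : ∀ x ∈ (J : Set G), (l ∘ₗ heckeProj μ hρ hJ ∘ₗ ρ s) (ρ x (ρ s v)) =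
      A.indicator (fun _ => l v - l w) x + l w := by
    intro x hx
    have h1 : (l ∘ₗ heckeProj μ hρ hJ ∘ₗ ρ s) (ρ x (ρ s v)) =
        l (heckeProj μ hρ hJ (ρ (s * x * s) v)) := by
      simp [mul_assoc]
    rw [h1]
    by_cases hxA : x ∈ A
    · rw [Set.indicator_of_mem hxA, hv _ hxA.2, heckeProj_of_mem μ hρ hJ hv, sub_add_cancel]
    · rw [Set.indicator_of_notMem hxA, zero_add]
      obtain h | ⟨a, ha, b, hb, h⟩ := hs.double_coset x hx
      · exact absurd ⟨hx, h⟩ hxA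
      · rw [h, map_mul, map_mul, Module.End.mul_apply, Module.End.mul_apply, hv b hb,
          heckeProj_apply_of_mem μ hρ hJ ha]
  have h1 := dual_heckeProj_setIntegral μ hρ hJ (ρ s v) (l ∘ₗ heckeProj μ hρ hJ ∘ₗ ρ s)
  rw [setIntegral_congr_fun hJ.measurableSet hval, integral_add, setIntegral_const,
    integral_indicator_const _ hAm, measureReal_restrict_apply hAm,
    Set.inter_eq_left.mpr hAJ] at h1
  · have hne : ((μ.real (J : Set G) : ℝ) : ℂ) ≠ 0 := by exact_mod_cast (hJ.real_pos μ).ne'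
    rw [map_add, map_smul, map_smul, returnProb, ← hA]
    refine h1.trans ?_
    simp only [Complex.real_smul, smul_eq_mul]
    field_simp
    ring
  · exact (integrable_indicator_iff hAm).mpr (integrableOn_const
      ((Measure.restrict_apply_le _ _).trans_lt
        ((measure_mono hAJ).trans_lt hJ.isCompact.measure_lt_top)).ne)
  · exact integrableOn_const hJfin

include hs in
/-- A left inverse of `e_I` on the vectors fixed by `J`. -/
theorem IsReflection.left_inverse {v : W} (hv : v ∈ fixedVectors ρ J) :
    (returnProb μ J s)⁻¹ • (heckeProj μ hρ hJ (heckeProj μ hρ hI v) -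
      (1 - returnProb μ J s) • ρ s⁻¹ (heckeProj μ hρ hI v)) = v := by
  have h1 : ∀ w, ρ s⁻¹ (ρ s w) = w := fun w => by simp [← Module.End.mul_apply, ← map_mul]
  rw [hs.heckeProj_eq μ hρ hI hJ, h1, hs.inv_apply hv, hs.quadratic μ hρ hJ hv,
    add_sub_cancel_right, inv_smul_smul₀ (returnProb_ne_zero μ hs hJ)]

include hs hJ in
/-- The map `e_I` from the vectors fixed by `J` to those fixed by `I` is bijective. -/
theorem IsReflection.bijective :
    Set.BijOn (heckeProj μ hρ hI) (fixedVectors ρ J : Set W) (fixedVectors ρ I : Set W) := by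
  refine ⟨fun v _ => heckeProj_mem μ hρ hI v, fun v hv w hw h => ?_, fun w hw => ?_⟩
  · rw [← hs.left_inverse μ hρ hI hJ hv, ← hs.left_inverse μ hρ hI hJ hw]
    simp only [show heckeProj μ hρ hI v = heckeProj μ hρ hI w from h]
  · have h1 : ρ s (ρ s⁻¹ w) = w := by simp [← Module.End.mul_apply, ← map_mul]
    set u := ρ s⁻¹ w with hu
    have huJ : u ∈ fixedVectors ρ J := hs.apply_mem_iff.mp (h1.symm ▸ hw)
    set c := returnProb μ J s with hc
    have hc0 : c ≠ 0 := returnProb_ne_zero μ hs hJ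
    -- With `T = e_J s`, this vector is `T⁻¹ u`, read off from `T² = c + (1 - c) T`; then `e_I = s
    -- T` sends it to `s u = w`.
    have hvJ : c⁻¹ • (heckeProj μ hρ hJ (ρ s u) - (1 - c) • u) ∈ fixedVectors ρ J :=
      Submodule.smul_mem _ _ (Submodule.sub_mem _ (heckeProj_mem μ hρ hJ _)
        (Submodule.smul_mem _ _ huJ))
    refine ⟨_, hvJ, ?_⟩
    rw [hs.heckeProj_eq μ hρ hI hJ, hs.inv_apply hvJ]
    simp only [map_smul, map_sub]
    rw [hs.quadratic μ hρ hJ huJ, map_add, add_sub_assoc]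
    simp only [map_smul, ← hc]
    rw [sub_self, add_zero, inv_smul_smul₀ hc0, h1]

/-- The element of the Hecke algebra that inverts `e_I` on the vectors fixed by `J`. -/
def reflectionInv (I J : Subgroup G) (s : G) (g : G) : ℂ :=
  (returnProb μ J s)⁻¹ * (idem μ J g - (1 - returnProb μ J s) * idem μ I (s * g))

include hI hJ in
theorem memHecke_reflectionInv : MemHecke (reflectionInv μ I J s) := by
  constructor
  · rw [IsLocallyConstant.iff_eventually_eq]
    intro x
    have h2 := ((isLocallyConstant_idem μ hI).comp_continuous
      (continuous_const_mul s)).eventually_eq x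
    filter_upwards [(isLocallyConstant_idem μ hJ).eventually_eq x, h2] with y h1 h2
    simp only [Function.comp_apply] at h2
    rw [reflectionInv, reflectionInv, h1, h2]
  · refine HasCompactSupport.mul_left (HasCompactSupport.sub (memHecke_idem μ hJ).2
      (HasCompactSupport.mul_left ?_))
    exact (memHecke_idem μ hI).2.comp_homeomorph (Homeomorph.mulLeft s)

include hs hJ in
theorem IsReflection.integral_reflectionInv {v : W} (hv : v ∈ fixedVectors ρ J)
    (l : Module.Dual ℂ W) :
    ∫ g, reflectionInv μ I J s g * l (ρ g (heckeProj μ hρ hI v)) ∂μ = l v := by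
  set w := heckeProj μ hρ hI v with hw
  -- The translate `g ↦ e_I (s g)` acts as `s⁻¹ e_I`, which is `s⁻¹` on the vector `w` fixed by `I`.
  -- It replaces the operator `s⁻¹`, which is not given by a function on `G`.
  have h1 : ∫ g, idem μ I (s * g) * l (ρ g w) ∂μ = l (ρ s⁻¹ w) := by
    rw [← integral_mul_left_eq_self _ s⁻¹]
    have h := dual_heckeProj μ hρ hI w (l ∘ₗ ρ s⁻¹)
    rw [heckeProj_of_mem μ hρ hI (heckeProj_mem μ hρ hI v)] at h
    rw [← LinearMap.comp_apply, h]
    simp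
  have hi1 := integrable_idem_mul μ hJ (hρ.continuous_dual w l)
  have hi2 : Integrable (fun g => idem μ I (s * g) * l (ρ g w)) μ := by
    have h := (integrable_idem_mul μ hI (hρ.continuous_dual w (l ∘ₗ ρ s⁻¹))).comp_mul_left s
    refine h.congr (.of_forall fun g => ?_)
    simp
  have h2 : ∀ g, reflectionInv μ I J s g * l (ρ g w) = (returnProb μ J s)⁻¹ *
      (idem μ J g * l (ρ g w) - (1 - returnProb μ J s) * (idem μ I (s * g) * l (ρ g w))) :=
    fun g => by rw [reflectionInv]; ring
  simp only [h2]
  rw [integral_const_mul, integral_sub hi1 (hi2.const_mul _), integral_const_mul, h1,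
    ← dual_heckeProj μ hρ hJ]
  conv_rhs => rw [← hs.left_inverse μ hρ hI hJ hv]
  simp [← hw]

end Reflection

/-! ### Regular representations and convolution identities -/

section SmoothVectors

variable {G : Type*} [Group G] [TopologicalSpace G] [IsTopologicalGroup G]
  {W : Type*} [AddCommGroup W] [Module ℂ W]

/-- The subspace of the vectors of a representation that are fixed by an open subgroup. -/
def smoothVectors (ρ : Representation ℂ G W) : Submodule ℂ W where
  carrier := {v | ∃ U : Subgroup G, IsOpen (U : Set G) ∧ v ∈ fixedVectors ρ U}
  zero_mem' := ⟨⊤, isOpen_univ, Submodule.zero_mem _⟩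
  add_mem' := by
    rintro v w ⟨U, hU, hv⟩ ⟨V, hV, hw⟩
    exact ⟨U ⊓ V, hU.inter hV, Submodule.add_mem _ (fun g hg => hv g hg.1) fun g hg => hw g hg.2⟩
  smul_mem' := by
    rintro c v ⟨U, hU, hv⟩
    exact ⟨U, hU, Submodule.smul_mem _ c hv⟩

theorem apply_mem_smoothVectors {ρ : Representation ℂ G W} (g : G) {v : W}
    (hv : v ∈ smoothVectors ρ) : ρ g v ∈ smoothVectors ρ := by
  obtain ⟨U, hU, hv⟩ := hv
  refine ⟨U.comap (MulAut.conj g⁻¹).toMonoidHom,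
    hU.preimage (by fun_prop : Continuous fun x : G => g⁻¹ * x * g⁻¹⁻¹),
    fun x hx => ?_⟩
  have h := congrArg (ρ g) (hv _ hx)
  simpa [← Module.End.mul_apply, ← map_mul, mul_assoc] using h

/-- The representation on the smooth vectors. -/
def smoothRep (ρ : Representation ℂ G W) : Representation ℂ G (smoothVectors ρ) where
  toFun g := (ρ g).restrict fun _ hv => apply_mem_smoothVectors g hv
  map_one' := by ext; simp
  map_mul' g h := by ext; simp

theorem coe_smoothRep (ρ : Representation ℂ G W) (g : G) (v : smoothVectors ρ) :
    (smoothRep ρ g v : W) = ρ g v := rfl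

theorem isSmooth_smoothRep (ρ : Representation ℂ G W) : IsSmooth (smoothRep ρ) := by
  rintro ⟨v, U, hU, hv⟩
  let S : Subgroup G :=
    { carrier := {g | ρ g v = v}
      one_mem' := by simp
      mul_mem' := fun {a b} (ha : ρ a v = v) (hb : ρ b v = v) => by
        simp [hb, ha]
      inv_mem' := fun {a} (ha : ρ a v = v) => by
        have h := congrArg (ρ a⁻¹) ha
        simpa [← Module.End.mul_apply, ← map_mul, eq_comm] using h }
  have h : IsOpen (S : Set G) := Subgroup.isOpen_mono (H₁ := U) (fun g hg => hv g hg) hU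
  convert h using 1
  ext g
  simp [S, Subtype.ext_iff, coe_smoothRep]

/-- The left regular representation on all functions. -/
def leftRegular (G : Type*) [Group G] : Representation ℂ G (G → ℂ) where
  toFun g := LinearMap.funLeft ℂ ℂ fun x => g⁻¹ * x
  map_one' := by ext; simp
  map_mul' g h := by ext; simp [LinearMap.funLeft_apply, mul_assoc]

/-- The right regular representation on all functions. -/
def rightRegular (G : Type*) [Group G] : Representation ℂ G (G → ℂ) where
  toFun g := LinearMap.funLeft ℂ ℂ fun x => x * g
  map_one' := by ext; simp
  map_mul' g h := by ext; simp [LinearMap.funLeft_apply, mul_assoc]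

theorem rightRegular_apply (g : G) (h : G → ℂ) (x : G) : rightRegular G g h x = h (x * g) := rfl

/-- Evaluation at a point, on the smooth vectors of a representation on functions. -/
def evalDual (ρ : Representation ℂ G (G → ℂ)) (x : G) : Module.Dual ℂ (smoothVectors ρ) :=
  (LinearMap.proj x) ∘ₗ (smoothVectors ρ).subtype

theorem evalDual_apply (ρ : Representation ℂ G (G → ℂ)) (x : G) (v : smoothVectors ρ) :
    evalDual ρ x v = (v : G → ℂ) x := rfl

variable [MeasurableSpace G] [BorelSpace G] (μ : Measure G) [μ.IsHaarMeasure]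
  {I J K : Subgroup G} {s t : G}

/-- Convolution on the left is the action on the left regular representation. -/
theorem conv_eq_leftRegular (f : G → ℂ) (h : smoothVectors (leftRegular G)) (x : G) :
    conv μ f h x = ∫ y, f y * evalDual _ x (smoothRep (leftRegular G) y h) ∂μ := rfl

/-- Convolution on the right is the action on the right regular representation. -/
theorem conv_eq_rightRegular (f : G → ℂ) (h : smoothVectors (rightRegular G)) (x : G) :
    conv μ h f x = ∫ y, f y⁻¹ * evalDual _ x (smoothRep (rightRegular G) y h) ∂μ := by
  -- The substitution `y ↦ x y` uses only left invariance; it is the reason why `f` appears composed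
  -- with inversion.
  rw [conv, ← integral_mul_left_eq_self _ x]
  congr 1
  funext y
  rw [evalDual_apply, coe_smoothRep, rightRegular_apply, mul_comm]
  simp

/-- Left multiplication by the Hecke algebra element `reflectionInv` recovers `e_J` from
`e_I e_J`. -/
theorem IsReflection.conv_left (hs : IsReflection I J s) (hI : IsCompactOpen I)
    (hJ : IsCompactOpen J) :
    conv μ (reflectionInv μ I J s) (conv μ (idem μ I) (idem μ J)) = idem μ J := by
  have hfix : idem μ J ∈ fixedVectors (leftRegular G) J := fun k hk => by
    funext x
    exact idem_mul_left μ (J.inv_mem hk) x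
  let v : smoothVectors (leftRegular G) := ⟨idem μ J, J, hJ.isOpen, hfix⟩
  have hv : v ∈ fixedVectors (smoothRep (leftRegular G)) J := fun k hk => Subtype.ext (hfix k hk)
  have hρ := isSmooth_smoothRep (leftRegular G)
  have h1 : conv μ (idem μ I) (idem μ J) = (heckeProj μ hρ hI v : G → ℂ) := by
    funext x
    exact (dual_heckeProj μ hρ hI v (evalDual _ x)).symm
  rw [h1]
  funext x
  rw [conv_eq_leftRegular]
  exact hs.integral_reflectionInv μ hρ hI hJ hv (evalDual _ x)

/-- Right multiplication by the Hecke algebra element `reflectionInv` recovers `e_I` from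
`e_I e_J`. -/
theorem IsReflection.conv_right (hs : IsReflection J I s) (hI : IsCompactOpen I)
    (hJ : IsCompactOpen J) :
    conv μ (conv μ (idem μ I) (idem μ J)) (fun g => reflectionInv μ J I s g⁻¹) = idem μ I := by
  have hfix : idem μ I ∈ fixedVectors (rightRegular G) I := fun k hk => by
    funext x
    exact idem_mul_right μ hk x
  let v : smoothVectors (rightRegular G) := ⟨idem μ I, I, hI.isOpen, hfix⟩
  have hv : v ∈ fixedVectors (smoothRep (rightRegular G)) I := fun k hk => Subtype.ext (hfix k hk)
  have hρ := isSmooth_smoothRep (rightRegular G)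
  -- Convolution on the right reverses the order of the operators: here `e_J` acts on the `I`-fixed
  -- vector `e_I`, so the two subgroups exchange roles.
  have h1 : conv μ (idem μ I) (idem μ J) = (heckeProj μ hρ hJ v : G → ℂ) := by
    funext x
    rw [show idem μ I = (v : G → ℂ) from rfl, conv_eq_rightRegular]
    simp only [idem_inv]
    exact (dual_heckeProj μ hρ hJ v (evalDual _ x)).symm
  rw [h1]
  funext x
  rw [conv_eq_rightRegular]
  simp only [inv_inv]
  exact hs.integral_reflectionInv μ hρ hJ hI hv (evalDual _ x)

theorem conv_idem_self (hJ : IsCompactOpen J) : conv μ (idem μ J) (idem μ J) = idem μ J := by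
  have hfix : idem μ J ∈ fixedVectors (leftRegular G) J := fun k hk => by
    funext x
    exact idem_mul_left μ (J.inv_mem hk) x
  let v : smoothVectors (leftRegular G) := ⟨idem μ J, J, hJ.isOpen, hfix⟩
  have hv : v ∈ fixedVectors (smoothRep (leftRegular G)) J := fun k hk => Subtype.ext (hfix k hk)
  have hρ := isSmooth_smoothRep (leftRegular G)
  funext x
  rw [show conv μ (idem μ J) (idem μ J) x = _ from
    (dual_heckeProj μ hρ hJ v (evalDual _ x)).symm, heckeProj_of_mem μ hρ hJ hv]
  rfl

/-- The Hecke algebra identities for two subgroups that are exchanged by a reflection. -/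
theorem exists_conv_eq (hI : IsCompactOpen I) (hJ : IsCompactOpen J) (hs : IsReflection I J s)
    (ht : IsReflection J I t) :
    ∃ f g : G → ℂ, MemHecke f ∧ MemHecke g ∧
      idem μ J = conv μ f (conv μ (idem μ I) (idem μ J)) ∧
      idem μ I = conv μ (conv μ (idem μ I) (idem μ J)) g := by
  refine ⟨reflectionInv μ I J s, fun g => reflectionInv μ J I t g⁻¹,
    memHecke_reflectionInv μ hI hJ, ?_, (hs.conv_left μ hI hJ).symm, (ht.conv_right μ hI hJ).symm⟩
  obtain ⟨h1, h2⟩ := memHecke_reflectionInv μ (s := t) hJ hI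
  exact ⟨h1.comp_continuous continuous_inv, h2.comp_homeomorph (Homeomorph.inv G)⟩

end SmoothVectors

/-! ### The normalized order and the topology of the local field -/

section Order

open WithZero IsNonarchimedeanLocalField

variable {F : Type*} [Field F] [ValuativeRel F] [TopologicalSpace F]
  [IsNonarchimedeanLocalField F]

/-- The valuation of a local field, with values in `ℤᵐ⁰`. -/
def intVal : Valuation F ℤᵐ⁰ :=
  (valuation F).map
    { toFun := valueGroupWithZeroIsoInt F
      map_zero' := map_zero _
      map_one' := map_one _
      map_mul' := map_mul _ }
    (valueGroupWithZeroIsoInt F).strictMono.monotone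

theorem intVal_apply (x : F) : intVal x = valueGroupWithZeroIsoInt F (valuation F x) := rfl

theorem intVal_le_intVal {x y : F} : intVal x ≤ intVal y ↔ x ≤ᵥ y := by
  rw [intVal_apply, intVal_apply, map_le_map_iff, ← Valuation.vle_iff_le]

theorem valuation_eq_one_iff {x : F} : valuation F x = 1 ↔ intVal x = 1 := by
  rw [intVal_apply, EmbeddingLike.map_eq_one_iff (f := valueGroupWithZeroIsoInt F)]

/-- The normalized order of a unit of `F`. -/
def ord (x : Fˣ) : ℤ := -log (intVal (x : F))

theorem intVal_unit (x : Fˣ) : intVal (x : F) = exp (-ord x) := by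
  rw [ord, neg_neg, exp_log ((Valuation.ne_zero_iff _).mpr x.ne_zero)]

theorem ord_mul (x y : Fˣ) : ord (x * y) = ord x + ord y := by
  have h := intVal_unit (x * y)
  rw [Units.val_mul, map_mul, intVal_unit, intVal_unit, ← exp_add, exp_inj] at h
  omega

theorem exists_ord_eq_one : ∃ w : Fˣ, ord w = 1 := by
  obtain ⟨γ, hγ⟩ := (valueGroupWithZeroIsoInt F).surjective (exp (-1 : ℤ))
  obtain ⟨x, rfl⟩ := valuation_surjective γ
  have hx : intVal x = exp (-1 : ℤ) := hγ
  have hx0 : x ≠ 0 := by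
    rintro rfl
    rw [map_zero] at hx
    exact exp_ne_zero hx.symm
  refine ⟨Units.mk0 x hx0, ?_⟩
  rw [ord, Units.val_mk0, hx, log_exp, neg_neg]

variable (F) in
/-- A uniformizer. -/
def unif : Fˣ := (exists_ord_eq_one (F := F)).choose

theorem ord_unif : ord (unif F) = 1 := (exists_ord_eq_one (F := F)).choose_spec

theorem ord_one : ord (1 : Fˣ) = 0 := by
  have := ord_mul (1 : Fˣ) 1
  rw [one_mul] at this
  omega

theorem ord_inv (x : Fˣ) : ord x⁻¹ = -ord x := by
  have := ord_mul x x⁻¹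
  rw [mul_inv_cancel, ord_one] at this
  omega

theorem ord_unif_zpow (n : ℤ) : ord (unif F ^ n) = n := by
  have hom : ∀ m : ℤ, ord (unif F ^ (m + 1)) = ord (unif F ^ m) + 1 := fun m => by
    rw [zpow_add_one, ord_mul, ord_unif]
  induction n with
  | zero => rw [zpow_zero, ord_one]
  | succ n ih => rw [hom, ih]
  | pred n ih =>
    have := hom (-n - 1)
    rw [sub_add_cancel] at this
    omega

theorem vle_iff_ord_le {x y : Fˣ} : (x : F) ≤ᵥ (y : F) ↔ ord y ≤ ord x := by
  rw [← intVal_le_intVal, intVal_unit, intVal_unit, exp_le_exp]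
  omega

variable (F) in
/-- The additive subgroup of all `x` with `intVal x ≤ exp n`. -/
def ballSubgroup (n : ℤ) : AddSubgroup F where
  carrier := {x : F | intVal x ≤ exp n}
  zero_mem' := by simp
  add_mem' := fun {a b} ha hb => (Valuation.map_add intVal a b).trans (max_le ha hb)
  neg_mem' := fun {a} ha => by simpa using ha

theorem mem_ballSubgroup {n : ℤ} {x : F} : x ∈ ballSubgroup F n ↔ intVal x ≤ exp n := Iff.rfl

theorem isOpen_ballSubgroup (n : ℤ) : IsOpen (ballSubgroup F n : Set F) := by
  refine AddSubgroup.isOpen_of_mem_nhds _ (g := 0) ?_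
  rw [(IsValuativeTopology.hasBasis_nhds_zero' F).mem_iff]
  refine ⟨(valueGroupWithZeroIsoInt F).symm (exp n), ?_, fun x hx => ?_⟩
  · simp
  · have h := (valueGroupWithZeroIsoInt F).strictMono.monotone (le_of_lt hx)
    rw [OrderMonoidIso.apply_symm_apply] at h
    exact h

theorem isCompact_ballSubgroup (n : ℤ) : IsCompact (ballSubgroup F n : Set F) := by
  convert isCompact_closedBall F ((valueGroupWithZeroIsoInt F).symm (exp n)) using 1
  ext x
  rw [SetLike.mem_coe, mem_ballSubgroup, intVal_apply, Set.mem_ofPred_eq,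
    ← map_le_map_iff (valueGroupWithZeroIsoInt F) (b := OrderMonoidIso.symm _ _),
    OrderMonoidIso.apply_symm_apply]

theorem t1Space : T1Space F := by
  refine IsTopologicalAddGroup.t1Space F ?_
  have h : ({0} : Set F) = ⋂ n : ℤ, (ballSubgroup F n : Set F) := by
    ext x
    simp only [Set.mem_singleton_iff, Set.mem_iInter, SetLike.mem_coe, mem_ballSubgroup]
    refine ⟨fun h n => by simp [h], fun h => ?_⟩
    by_contra hx
    obtain ⟨y, rfl⟩ : ∃ y : Fˣ, x = y := ⟨Units.mk0 x hx, rfl⟩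
    have h1 := h (-ord y - 1)
    rw [intVal_unit, exp_le_exp] at h1
    omega
  rw [h]
  exact isClosed_iInter fun n => AddSubgroup.isClosed_of_isOpen _ (isOpen_ballSubgroup n)

/-- The condition `ord x ≥ n`. -/
def OrdGe (n : ℤ) (x : F) : Prop := intVal x ≤ exp (-n)

theorem OrdGe.mono {m n : ℤ} {x : F} (h : OrdGe n x) (hmn : m ≤ n) : OrdGe m x :=
  h.trans (exp_le_exp.mpr (by omega))

theorem OrdGe.mul {m n : ℤ} {x y : F} (hx : OrdGe m x) (hy : OrdGe n y) : OrdGe (m + n) (x * y) := by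
  rw [OrdGe, map_mul, neg_add, exp_add]
  exact mul_le_mul' hx hy

theorem OrdGe.add {n : ℤ} {x y : F} (hx : OrdGe n x) (hy : OrdGe n y) : OrdGe n (x + y) :=
  (Valuation.map_add _ _ _).trans (max_le hx hy)

theorem OrdGe.neg {n : ℤ} {x : F} (hx : OrdGe n x) : OrdGe n (-x) := by
  rwa [OrdGe, Valuation.map_neg]

theorem ordGe_zero (n : ℤ) : OrdGe n (0 : F) := by simp [OrdGe]

theorem ordGe_one : OrdGe 0 (1 : F) := by simp [OrdGe]

theorem ordGe_unit {n : ℤ} {x : Fˣ} : OrdGe n (x : F) ↔ n ≤ ord x := by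
  rw [OrdGe, intVal_unit, exp_le_exp]
  omega

theorem ordGe_sum {ι : Type*} {n : ℤ} {s : Finset ι} {f : ι → F} (h : ∀ i ∈ s, OrdGe n (f i)) :
    OrdGe n (∑ i ∈ s, f i) := Valuation.map_sum_le _ h

theorem exists_unit_of_not_ordGe {n : ℤ} {x : F} (h : ¬ OrdGe n x) : ∃ y : Fˣ, x = y ∧ ord y < n := by
  have hx : x ≠ 0 := by
    rintro rfl
    exact h (ordGe_zero n)
  refine ⟨Units.mk0 x hx, rfl, ?_⟩
  rw [← not_le, ← ordGe_unit]
  exact h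

theorem ordGe_iff_vle {x : F} {y : Fˣ} : OrdGe (ord y) x ↔ x ≤ᵥ (y : F) := by
  rw [← intVal_le_intVal, intVal_unit, OrdGe]

theorem mem_integer_iff {x : F} : x ∈ 𝒪[F] ↔ OrdGe 0 x := by
  have h : x ∈ 𝒪[F] ↔ x ≤ᵥ (1 : Fˣ) := by
    rw [Valuation.mem_integer_iff, Units.val_one, Valuation.vle_one_iff (v := valuation F)]
  rw [h, ← ordGe_iff_vle, ord_one]

end Order

/-! ### Position vectors and their ceilings -/

section Gap

variable {N : ℕ} [NeZero N]

/-- For a vector `pos` of positions, the ceiling of `(pos j - pos i) / N`. -/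
def gap (pos : Fin N → ℤ) (i j : Fin N) : ℤ := -((pos i - pos j) / N)

theorem gap_le_iff {pos : Fin N → ℤ} {i j : Fin N} {k : ℤ} :
    gap pos i j ≤ k ↔ pos j - pos i ≤ k * N := by
  have hN : (0 : ℤ) < N := by exact_mod_cast NeZero.pos N
  rw [gap, neg_le, Int.le_ediv_iff_mul_le hN]
  constructor <;> intro h <;> linarith

theorem le_gap_mul (pos : Fin N → ℤ) (i j : Fin N) : pos j - pos i ≤ gap pos i j * N :=
  gap_le_iff.mp le_rfl

theorem gap_mul_lt (pos : Fin N → ℤ) (i j : Fin N) : (gap pos i j - 1) * N < pos j - pos i := by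
  by_contra! h
  have := gap_le_iff.mpr h
  omega

theorem gap_self (pos : Fin N → ℤ) (i : Fin N) : gap pos i i = 0 := by simp [gap]

theorem gap_triangle (pos : Fin N → ℤ) (i j k : Fin N) :
    gap pos i k ≤ gap pos i j + gap pos j k := by
  rw [gap_le_iff]
  linarith [le_gap_mul pos i j, le_gap_mul pos j k, add_mul (gap pos i j) (gap pos j k) (N : ℤ)]

/-- The positions are distinct modulo `N`. -/
def IsRegular (pos : Fin N → ℤ) : Prop := ∀ i j, ∀ m : ℤ, pos j - pos i = m * N → i = j

/-- The ceilings of `x` and `-x` add up to 1 when `x` is not an integer. Lower bounds for gaps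
thereby follow from upper bounds for the opposite ones. -/
theorem gap_add_gap {pos : Fin N → ℤ} (hpos : IsRegular pos) {i j : Fin N} (hij : i ≠ j) :
    gap pos i j + gap pos j i = 1 := by
  have hN : (0 : ℤ) < N := by exact_mod_cast NeZero.pos N
  have h1 := le_gap_mul pos i j
  have h2 := le_gap_mul pos j i
  have h3 := gap_mul_lt pos i j
  have h4 := gap_mul_lt pos j i
  have h5 : pos j - pos i ≠ gap pos i j * N := fun h => hij (hpos _ _ _ h)
  have h6 : 0 < gap pos i j + gap pos j i := by
    by_contra! h
    nlinarith [lt_of_le_of_ne h1 h5]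
  have h7 : gap pos i j + gap pos j i < 2 := by
    by_contra! h
    nlinarith
  omega

end Gap

/-! ### Iwahori subgroups described by bounds on matrix entries -/

section PosIwahori

open WithZero

variable {F : Type*} [Field F] [ValuativeRel F] [TopologicalSpace F]
  [IsNonarchimedeanLocalField F] {N : ℕ} [NeZero N]

/-- Taking `N`-th powers removes the rounding, so that bounds for the entries multiply without loss
in a determinant. -/
theorem ordGe_ediv_iff {n : ℤ} {x : F} : OrdGe (-(n / N)) x ↔ intVal x ^ N ≤ exp n := by
  have hN : (0 : ℤ) < N := by exact_mod_cast NeZero.pos N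
  by_cases hx : x = 0
  · subst hx
    simp [OrdGe, NeZero.ne N]
  · obtain ⟨y, rfl⟩ : ∃ y : Fˣ, x = y := ⟨Units.mk0 x hx, rfl⟩
    rw [ordGe_unit, neg_le, Int.le_ediv_iff_mul_le hN, intVal_unit, ← exp_nsmul, exp_le_exp,
      nsmul_eq_mul, mul_comm]

theorem ordGe_gap_iff {pos : Fin N → ℤ} {i j : Fin N} {x : F} :
    OrdGe (gap pos i j) x ↔ intVal x ^ N ≤ exp (pos i - pos j) := ordGe_ediv_iff

/-- A bound for a determinant, from bounds for the entries. -/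
theorem intVal_det_pow_le {M : Matrix (Fin N) (Fin N) F} {p q : Fin N → ℤ}
    (h : ∀ i j, intVal (M i j) ^ N ≤ exp (q i - p j)) :
    intVal M.det ^ N ≤ exp (∑ i, q i - ∑ i, p i) := by
  rw [Matrix.det_apply']
  -- By the ultrametric inequality one term of the Leibniz formula dominates the sum. In the bound
  -- for that term the permutation disappears on summing `q (σ i) - p i`.
  obtain ⟨σ, hσ⟩ : ∃ σ : Equiv.Perm (Fin N),
      intVal (∑ σ : Equiv.Perm (Fin N), ((Equiv.Perm.sign σ : ℤ) : F) * ∏ i, M (σ i) i) ≤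
        intVal (∏ i, M (σ i) i) := by
    by_contra! hlt
    refine lt_irrefl _ (Valuation.map_sum_lt' (v := intVal (F := F)) (lt_of_le_of_lt zero_le
      (hlt 1)) (s := Finset.univ) (fun σ _ => ?_))
    rw [map_mul]
    refine lt_of_eq_of_lt ?_ (hlt σ)
    obtain h | h := Int.units_eq_one_or (Equiv.Perm.sign σ) <;> simp [h]
  refine (pow_le_pow_left' hσ N).trans ?_
  rw [map_prod, ← Finset.prod_pow]
  refine (Finset.prod_le_prod' fun i _ => h (σ i) i).trans ?_
  have : ∀ (s : Finset (Fin N)) (f : Fin N → ℤ), ∏ i ∈ s, exp (f i) = exp (∑ i ∈ s, f i) := by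
    intro s f
    classical
    induction s using Finset.induction_on with
    | empty => simp
    | insert a s ha ih => rw [Finset.prod_insert ha, Finset.sum_insert ha, ih, exp_add]
  rw [this, Finset.sum_sub_distrib, Equiv.sum_comp σ q]

/-- The matrices whose entries satisfy `N ord (g i j) ≥ pos j - pos i`. -/
def PosBound (pos : Fin N → ℤ) (M : Matrix (Fin N) (Fin N) F) : Prop :=
  ∀ i j, OrdGe (gap pos i j) (M i j)

theorem PosBound.mul {pos : Fin N → ℤ} {A B : Matrix (Fin N) (Fin N) F} (hA : PosBound pos A)
    (hB : PosBound pos B) : PosBound pos (A * B) := fun i k => by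
  rw [Matrix.mul_apply]
  exact ordGe_sum fun j _ => ((hA i j).mul (hB j k)).mono (gap_triangle pos i j k)

/-- An entry of the adjugate is the determinant with row `j` replaced by the `i`-th unit vector.
This row satisfies the bounds for the row position `pos i` in place of `pos j`, so the determinant
bound gains exactly `pos i - pos j`. -/
theorem PosBound.adjugate {pos : Fin N → ℤ} {A : Matrix (Fin N) (Fin N) F}
    (hA : PosBound pos A) : PosBound pos A.adjugate := fun i j => by
  rw [ordGe_gap_iff, Matrix.adjugate_apply]
  refine (intVal_det_pow_le (p := pos) (q := Function.update pos j (pos i)) fun a b => ?_).trans ?_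
  · by_cases ha : a = j
    · subst ha
      by_cases hb : b = i
      · subst hb
        simp
      · simp [hb, NeZero.ne N]
    · rw [Matrix.updateRow_ne ha, Function.update_of_ne ha]
      exact ordGe_gap_iff.mp (hA a b)
  · rw [Finset.sum_update_of_mem (Finset.mem_univ j),
      ← Finset.sum_sdiff (Finset.subset_univ {j}) (f := pos), Finset.sum_singleton]
    exact exp_le_exp.mpr (by linarith)

theorem PosBound.intVal_det_le {pos : Fin N → ℤ} {A : Matrix (Fin N) (Fin N) F}
    (hA : PosBound pos A) : intVal A.det ≤ 1 := by
  have h := intVal_det_pow_le (p := pos) (q := pos) fun i j => ordGe_gap_iff.mp (hA i j)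
  rw [sub_self, exp_zero] at h
  by_contra! hlt
  exact absurd h (not_le.mpr (one_lt_pow' hlt (NeZero.ne N)))

theorem posBound_one (pos : Fin N → ℤ) : PosBound pos (1 : Matrix (Fin N) (Fin N) F) :=
  fun i j => by
    by_cases h : i = j
    · subst h
      rw [gap_self, Matrix.one_apply_eq]
      exact ordGe_one
    · rw [Matrix.one_apply_ne h]
      exact ordGe_zero _

variable (F) in
/-- The Iwahori subgroup attached to a vector of positions. -/
def posIwahori (pos : Fin N → ℤ) : Subgroup (GL (Fin N) F) where
  carrier := {g | intVal (g : Matrix (Fin N) (Fin N) F).det = 1 ∧ PosBound pos (g : Matrix _ _ F)}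
  one_mem' := ⟨by simp, posBound_one pos⟩
  mul_mem' := fun {a b} ha hb => ⟨by simp [ha.1, hb.1], by
    rw [Units.val_mul]
    exact ha.2.mul hb.2⟩
  inv_mem' := fun {g} hg => by
    have hdet : IsUnit (g : Matrix (Fin N) (Fin N) F).det := by
      simpa using (Matrix.isUnits_det_units g)
    refine ⟨?_, ?_⟩
    · rw [Matrix.coe_units_inv, Matrix.det_nonsing_inv, Ring.inverse_eq_inv', map_inv₀, hg.1,
        inv_one]
    · intro i j
      rw [Matrix.coe_units_inv, Matrix.inv_def, Ring.inverse_eq_inv', Matrix.smul_apply,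
        smul_eq_mul]
      have h1 : OrdGe 0 (g : Matrix (Fin N) (Fin N) F).det⁻¹ := by
        rw [OrdGe, map_inv₀, hg.1]
        simp
      simpa using h1.mul (hg.2.adjugate i j)

theorem mem_posIwahori {pos : Fin N → ℤ} {g : GL (Fin N) F} : g ∈ posIwahori F pos ↔
    intVal (g : Matrix (Fin N) (Fin N) F).det = 1 ∧ PosBound pos (g : Matrix _ _ F) := Iff.rfl

/-- The bounds make both determinants integral, so that they are units. The symmetric form describes
the group as a preimage under `g ↦ (g, g⁻¹)`. -/
theorem mem_posIwahori_iff_inv {pos : Fin N → ℤ} {g : GL (Fin N) F} : g ∈ posIwahori F pos ↔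
    PosBound pos (g : Matrix _ _ F) ∧ PosBound pos ((g⁻¹ : GL (Fin N) F) : Matrix _ _ F) := by
  refine ⟨fun h => ⟨h.2, ((posIwahori F pos).inv_mem h).2⟩, fun h => ⟨?_, h.1⟩⟩
  refine le_antisymm h.1.intVal_det_le ?_
  have h1 := h.2.intVal_det_le
  rwa [Matrix.coe_units_inv, Matrix.det_nonsing_inv, Ring.inverse_eq_inv', map_inv₀,
    inv_le_one₀ ] at h1
  rw [zero_lt_iff, Valuation.ne_zero_iff]
  exact ((Matrix.isUnit_iff_isUnit_det _).mp g.isUnit).ne_zero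

theorem isCompactOpen_posIwahori (pos : Fin N → ℤ) : IsCompactOpen (posIwahori F pos) := by
  set S : Set (Matrix (Fin N) (Fin N) F) := {M | PosBound pos M} with hS
  have hSpi : S = Set.univ.pi fun i => Set.univ.pi fun j =>
      (ballSubgroup F (-gap pos i j) : Set F) := by
    ext M
    exact ⟨fun h i _ j _ => h i j, fun h i j => h i trivial j trivial⟩
  have hSo : IsOpen S := by
    rw [hSpi]
    exact isOpen_set_pi Set.finite_univ fun i _ => isOpen_set_pi Set.finite_univ fun j _ =>
      isOpen_ballSubgroup _
  have hSc : IsCompact S := by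
    rw [hSpi]
    exact isCompact_univ_pi fun i => isCompact_univ_pi fun j => isCompact_ballSubgroup _
  -- Separation is used for the closedness of the embedding `g ↦ (g, g⁻¹)`, through which
  -- compactness is pulled back.
  have := t1Space (F := F)
  have : T1Space (Matrix (Fin N) (Fin N) F) := inferInstanceAs (T1Space (Fin N → Fin N → F))
  have hpre : (posIwahori F pos : Set (GL (Fin N) F)) =
      Units.embedProduct _ ⁻¹' (S ×ˢ (MulOpposite.unop ⁻¹' S)) := by
    ext g
    exact mem_posIwahori_iff_inv
  constructor
  · rw [hpre]
    exact (hSo.prod (hSo.preimage MulOpposite.continuous_unop)).preimage Units.continuous_embedProduct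
  · rw [hpre]
    refine Units.isClosedEmbedding_embedProduct.isCompact_preimage (hSc.prod ?_)
    rw [← MulOpposite.opHomeomorph.symm.isCompact_preimage] at hSc
    exact hSc

end PosIwahori

/-! ### Crossing a wall: exchange of neighbouring positions -/

section SwapPos

variable {N : ℕ} [NeZero N]

theorem gap_eq_iff {pos : Fin N → ℤ} {i j : Fin N} {k : ℤ} :
    gap pos i j = k ↔ pos j - pos i ≤ k * N ∧ k * N < pos j - pos i + N := by
  have h1 := gap_le_iff (pos := pos) (i := i) (j := j) (k := k)
  have h2 := gap_le_iff (pos := pos) (i := i) (j := j) (k := k - 1)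
  rw [sub_mul, one_mul] at h2
  omega

/-- Exchange of the positions of `e i` and of a multiple of `e j`, when these are neighbours. -/
def swapPos (pos : Fin N → ℤ) (i j : Fin N) : Fin N → ℤ :=
  Function.update (Function.update pos i (pos i + 1)) j (pos j - 1)

/-- `e j` is the successor of `w ^ m e i`, where `w` is a uniformizer. -/
structure IsSucc (pos : Fin N → ℤ) (i j : Fin N) (m : ℤ) : Prop where
  regular : IsRegular pos
  ne : i ≠ j
  eq : pos j = pos i + 1 + m * N

namespace IsSucc

variable {pos : Fin N → ℤ} {i j : Fin N} {m : ℤ} (h : IsSucc pos i j m)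

include h

theorem swapPos_left : swapPos pos i j i = pos i + 1 := by
  rw [swapPos, Function.update_of_ne h.ne, Function.update_self]

theorem swapPos_right : swapPos pos i j j = pos j - 1 := by
  rw [swapPos, Function.update_self]

theorem swapPos_of_ne {k : Fin N} (hi : k ≠ i) (hj : k ≠ j) : swapPos pos i j k = pos k := by
  rw [swapPos, Function.update_of_ne hj, Function.update_of_ne hi]

theorem one_lt : (1 : ℤ) < N := by
  have h1 := h.ne
  have hN : N ≠ 1 := by
    rintro rfl
    exact h1 (Subsingleton.elim _ _)
  have := NeZero.ne N
  omega

theorem gap_left_right : gap pos i j = m + 1 := by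
  have := h.eq
  have := h.one_lt
  rw [gap_eq_iff, add_mul, one_mul]
  omega

theorem gap_right_left : gap pos j i = -m := by
  have := gap_add_gap h.regular h.ne
  rw [h.gap_left_right] at this
  omega

/-- The positions of `w ^ m e i` and `e j` are consecutive. The two ceilings could differ only if a
multiple of `e k` had the position of a multiple of `e j`, which regularity excludes. -/
theorem gap_left {k : Fin N} (hj : k ≠ j) : gap pos i k = gap pos j k + m := by
  have h1 := h.eq
  have h2 := h.one_lt
  obtain ⟨h3, h4⟩ := gap_eq_iff.mp (rfl : gap pos j k = _)
  have h5 : pos k - pos j ≠ gap pos j k * N := fun h' => hj (h.regular _ _ _ h').symm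
  rw [gap_eq_iff, add_mul]
  omega

theorem gap_swap_left {k : Fin N} (hi : k ≠ i) (hj : k ≠ j) :
    gap (swapPos pos i j) i k = gap pos i k := by
  have h1 := h.eq
  have h2 := h.one_lt
  obtain ⟨h3, h4⟩ := gap_eq_iff.mp (rfl : gap pos i k = _)
  have h5 : pos k - pos j ≠ (gap pos i k - 1 - m) * N := fun h' => hj (h.regular _ _ _ h').symm
  rw [sub_mul, sub_mul, one_mul] at h5
  rw [gap_eq_iff, h.swapPos_left, h.swapPos_of_ne hi hj]
  omega

theorem gap_swap_right {k : Fin N} (hi : k ≠ i) (hj : k ≠ j) :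
    gap (swapPos pos i j) j k = gap pos j k := by
  have h1 := h.eq
  have h2 := h.one_lt
  obtain ⟨h3, h4⟩ := gap_eq_iff.mp (rfl : gap pos j k = _)
  have h5 : pos k - pos j ≠ gap pos j k * N := fun h' => hj (h.regular _ _ _ h').symm
  rw [gap_eq_iff, h.swapPos_right, h.swapPos_of_ne hi hj]
  omega

/-- In this form the exchange is an affine reflection: a transposition followed by translations by
multiples of `N`. The same exponents define the matrix `reflMatrix`. -/
theorem swap_eq (x : Fin N) : swapPos pos i j x =
    pos (Equiv.swap i j x) + (if x = j then m else if x = i then -m else 0) * N := by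
  have h1 := h.eq
  by_cases hj : x = j
  · subst hj
    rw [h.swapPos_right, Equiv.swap_apply_right, if_pos rfl]
    omega
  by_cases hi : x = i
  · subst hi
    rw [h.swapPos_left, Equiv.swap_apply_left, if_neg h.ne, if_pos rfl, neg_mul]
    omega
  · rw [h.swapPos_of_ne hi hj, Equiv.swap_apply_of_ne_of_ne hi hj, if_neg hj, if_neg hi]
    omega

theorem regular_swap : IsRegular (swapPos pos i j) := fun a b k hk => by
  rw [h.swap_eq, h.swap_eq] at hk
  refine (Equiv.swap i j).injective (h.regular _ _
    (k - (if b = j then m else if b = i then -m else 0) +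
      (if a = j then m else if a = i then -m else 0)) ?_)
  rw [add_mul, sub_mul]
  linarith

/-- The exchange of positions can be undone. -/
theorem symm : IsSucc (swapPos pos i j) j i (-m) where
  regular := h.regular_swap
  ne := h.ne.symm
  eq := by
    rw [h.swapPos_left, h.swapPos_right, neg_mul, h.eq]
    omega

theorem swapPos_swapPos : swapPos (swapPos pos i j) j i = pos := by
  funext k
  by_cases hi : k = i
  · subst hi
    rw [h.symm.swapPos_right, h.swapPos_left]
    omega
  by_cases hj : k = j
  · subst hj
    rw [h.symm.swapPos_left, h.swapPos_right]
    omega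
  rw [h.symm.swapPos_of_ne hj hi, h.swapPos_of_ne hi hj]

theorem gap_swap_left_right : gap (swapPos pos i j) i j = m := by
  have := h.symm.gap_right_left
  omega

theorem gap_swap_right_left : gap (swapPos pos i j) j i = -m + 1 := h.symm.gap_left_right

/-- Only one wall is crossed. Pairs whose first index is `i` or `j` are compared directly, and those
whose second index is `i` or `j` through `gap_add_gap`. -/
theorem gap_swap_of_ne {a b : Fin N} (h1 : ¬ (a = i ∧ b = j)) (h2 : ¬ (a = j ∧ b = i)) :
    gap (swapPos pos i j) a b = gap pos a b := by
  by_cases hab : a = b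
  · rw [hab, gap_self, gap_self]
  have key : ∀ a b : Fin N, a ≠ b → (a = i ∨ a = j) → ¬ (a = i ∧ b = j) → ¬ (a = j ∧ b = i) →
      gap (swapPos pos i j) a b = gap pos a b := by
    rintro a b hab (rfl | rfl) h1 h2
    · exact h.gap_swap_left (Ne.symm hab) (by tauto)
    · exact h.gap_swap_right (by tauto) (Ne.symm hab)
  by_cases ha : a = i ∨ a = j
  · exact key a b hab ha h1 h2
  by_cases hb : b = i ∨ b = j
  · have := key b a (Ne.symm hab) hb (by tauto) (by tauto)
    have := gap_add_gap h.regular hab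
    have := gap_add_gap h.regular_swap hab
    omega
  · push Not at ha hb
    rw [gap, gap, h.swapPos_of_ne ha.1 ha.2, h.swapPos_of_ne hb.1 hb.2]

end IsSucc

end SwapPos

/-! ### Factorization of Iwahori subgroups and the reflection matrix -/

section Matrices

variable {F : Type*} [Field F] [ValuativeRel F] [TopologicalSpace F]
  [IsNonarchimedeanLocalField F] {N : ℕ} [NeZero N]

/-- The matrix `1 + ∑ i, c i E_{i a}`. -/
def columnMatrix (a : Fin N) (c : Fin N → F) : Matrix (Fin N) (Fin N) F :=
  1 + Matrix.vecMulVec c (Pi.single a 1)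

theorem columnMatrix_mul_apply (a : Fin N) (c : Fin N → F) (M : Matrix (Fin N) (Fin N) F)
    (i j : Fin N) : (columnMatrix a c * M) i j = M i j + c i * M a j := by
  rw [columnMatrix, add_mul, one_mul, Matrix.add_apply, Matrix.vecMulVec_mul]
  simp [Matrix.vecMulVec_apply]

theorem det_columnMatrix {a : Fin N} {c : Fin N → F} (hc : c a = 0) :
    (columnMatrix a c).det = 1 := by
  rw [columnMatrix, Matrix.vecMulVec_eq Unit, Matrix.det_one_add_replicateCol_mul_replicateRow]
  simp [hc]

/-- The matrix `columnMatrix a c`, as an element of the general linear group. -/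
def columnGL (a : Fin N) (c : Fin N → F) (hc : c a = 0) : GL (Fin N) F :=
  Matrix.GeneralLinearGroup.mkOfDetNeZero (columnMatrix a c) (by simp [det_columnMatrix hc])

theorem coe_columnGL (a : Fin N) (c : Fin N → F) (hc : c a = 0) :
    (columnGL a c hc : Matrix (Fin N) (Fin N) F) = columnMatrix a c := rfl

theorem columnGL_mem {pos : Fin N → ℤ} {a : Fin N} {c : Fin N → F} (hc : c a = 0)
    (h : ∀ i, OrdGe (gap pos i a) (c i)) : columnGL a c hc ∈ posIwahori F pos := by
  refine ⟨by rw [coe_columnGL, det_columnMatrix hc, map_one], fun i j => ?_⟩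
  rw [coe_columnGL, ← mul_one (columnMatrix a c), columnMatrix_mul_apply]
  refine (posBound_one pos i j).add ?_
  by_cases hj : a = j
  · subst hj
    simpa using h i
  · rw [Matrix.one_apply_ne hj, mul_zero]
    exact ordGe_zero _

/-- The diagonal entries of the elements of an Iwahori subgroup are units. -/
theorem exists_unit_diag {pos : Fin N → ℤ} (hpos : IsRegular pos) {g : GL (Fin N) F}
    (hg : g ∈ posIwahori F pos) (a : Fin N) :
    ∃ y : Fˣ, (g : Matrix (Fin N) (Fin N) F) a a = y ∧ ord y = 0 := by
  obtain ⟨h1, h2⟩ := mem_posIwahori_iff_inv.mp hg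
  have h3 : ((g : Matrix (Fin N) (Fin N) F) *
      ((g⁻¹ : GL (Fin N) F) : Matrix (Fin N) (Fin N) F)) a a = 1 := by
    rw [← Units.val_mul, mul_inv_cancel, Units.val_one, Matrix.one_apply_eq]
  -- In the diagonal entry of `g g⁻¹ = 1`, the terms with `j ≠ a` have order at least `gap pos a j +
  -- gap pos j a = 1`, so the remaining term must have order 0.
  have h4 : ¬ OrdGe 1 ((g : Matrix (Fin N) (Fin N) F) a a) := by
    intro h
    have h5 : OrdGe 1 (1 : F) := by
      rw [← h3, Matrix.mul_apply]
      refine ordGe_sum fun j _ => ?_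
      by_cases hj : a = j
      · subst hj
        simpa [gap_self] using h.mul (h2 a a)
      · refine ((h1 a j).mul (h2 j a)).mono (gap_add_gap hpos hj).ge
    rw [show (1 : F) = (1 : Fˣ) from rfl, ordGe_unit, ord_one] at h5
    omega
  obtain ⟨y, hy, hlt⟩ := exists_unit_of_not_ordGe h4
  refine ⟨y, hy, ?_⟩
  have h5 := h1 a a
  rw [hy, gap_self, ordGe_unit] at h5
  omega

/-- If the positions `p` are between the positions `q` and `r`, then the Iwahori subgroup of `p`
is contained in the product of those of `q` and `r`. -/
theorem exists_factorization {p q r : Fin N → ℤ} (hp : IsRegular p)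
    (h : ∀ i j, i ≠ j → min (gap q i j) (gap r i j) ≤ gap p i j) {k : GL (Fin N) F}
    (hk : k ∈ posIwahori F p) : ∃ a ∈ posIwahori F q, ∃ b ∈ posIwahori F r, k = a * b := by
  -- Indices are ordered by `q i - r i`, with ties broken by the index. For `key j < key i` the
  -- smaller of the two gaps at `(i, j)` is that of `q`, for `key i < key j` that of `r`: below the
  -- diagonal the bounds of `p` imply those of `q`, above it those of `r`.
  set key : Fin N → ℤ := fun i => N * (q i - r i) + (i : ℕ) with hkey
  have hmono : ∀ i j, key i < key j → q i - r i ≤ q j - r j := by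
    intro i j hij
    by_contra! hlt
    have h2 : ((i : ℕ) : ℤ) < N := by exact_mod_cast i.2
    have h3 : ((j : ℕ) : ℤ) < N := by exact_mod_cast j.2
    simp only [hkey] at hij
    nlinarith
  have hinj : Function.Injective key := by
    intro i j hij
    have h2 : ((i : ℕ) : ℤ) < N := by exact_mod_cast i.2
    have h3 : ((j : ℕ) : ℤ) < N := by exact_mod_cast j.2
    have h4 : key i % N = key j % N := by rw [hij]
    simp only [hkey, Int.mul_add_emod_self_left] at h4
    rw [Int.emod_eq_of_lt (by omega) h2, Int.emod_eq_of_lt (by omega) h3] at h4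
    exact Fin.ext (by exact_mod_cast h4)
  -- Columns are cleared below the diagonal in increasing order of `key`, with unit pivots. The
  -- multipliers satisfy the bounds of both `p` and `q`.
  have main : ∀ T : Finset (Fin N), ∃ u ∈ posIwahori F q, u ∈ posIwahori F p ∧
      ∀ j ∈ T, ∀ i, key j < key i → ((u * k : GL (Fin N) F) : Matrix (Fin N) (Fin N) F) i j = 0 := by
    intro T
    induction T using Finset.induction_on_max_value key with
    | empty => exact ⟨1, one_mem _, one_mem _, by simp⟩
    | insert a T ha hmax ih =>
      obtain ⟨u, huq, hup, hu⟩ := ih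
      have hM : u * k ∈ posIwahori F p := mul_mem hup hk
      obtain ⟨y, hy, hy0⟩ := exists_unit_diag hp hM a
      set M : Matrix (Fin N) (Fin N) F := ((u * k : GL (Fin N) F) : Matrix (Fin N) (Fin N) F) with hMdef
      set c : Fin N → F := fun i => if key a < key i then -M i a * (y⁻¹ : Fˣ) else 0 with hc
      have hca : c a = 0 := by simp [hc]
      have hinv : ord y⁻¹ = 0 := by rw [ord_inv, hy0, neg_zero]
      have hcp : ∀ i, OrdGe (gap p i a) (c i) := by
        intro i
        simp only [hc]
        split_ifs with hi
        · have := (hM.2 i a).neg.mul (ordGe_unit.mpr hinv.ge)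
          rwa [add_zero] at this
        · exact ordGe_zero _
      have hcq : ∀ i, OrdGe (gap q i a) (c i) := by
        intro i
        by_cases hi : key a < key i
        · refine (hcp i).mono ?_
          have h1 := h i a (fun h' => by simp [h'] at hi)
          have h2 : gap q i a ≤ gap r i a := by
            rw [gap_le_iff]
            linarith [le_gap_mul r i a, hmono _ _ hi]
          rwa [min_eq_left h2] at h1
        · simp only [hc, if_neg hi]
          exact ordGe_zero _
      refine ⟨columnGL a c hca * u, mul_mem (columnGL_mem hca hcq) huq,
        mul_mem (columnGL_mem hca hcp) hup, fun j hj i hi => ?_⟩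
      rw [mul_assoc, Units.val_mul, coe_columnGL, columnMatrix_mul_apply, ← hMdef]
      obtain rfl | hj := Finset.mem_insert.mp hj
      · simp only [hc, if_pos hi, hy]
        simp
      -- The row operation adds multiples of row `a`, whose entry in an earlier column is already
      -- zero, so cleared columns stay cleared.
      · have h1 : key j < key a := lt_of_le_of_ne (hmax j hj)
          (fun h' => ha (hinj h' ▸ hj))
        rw [hu j hj i hi, hu j hj a h1, mul_zero, add_zero]
  obtain ⟨u, huq, hup, hu⟩ := main Finset.univ
  refine ⟨u⁻¹, inv_mem huq, u * k, ⟨(mul_mem hup hk).1, fun i j => ?_⟩, by group⟩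
  obtain hij | hij | hij := lt_trichotomy (key i) (key j)
  · refine ((mul_mem hup hk).2 i j).mono ?_
    have h1 := h i j (fun h' => by simp [h'] at hij)
    have h2 : gap r i j ≤ gap q i j := by
      rw [gap_le_iff]
      linarith [le_gap_mul q i j, hmono _ _ hij]
    rwa [min_eq_right h2] at h1
  · obtain rfl := hinj hij
    have := (mul_mem hup hk).2 i i
    rwa [gap_self] at this ⊢
  · rw [hu j (Finset.mem_univ j) i hij]
    exact ordGe_zero _

/-- The monomial matrix with entries `t b` at the places `(σ b, b)`. -/
def monomialMatrix (σ : Equiv.Perm (Fin N)) (t : Fin N → F) : Matrix (Fin N) (Fin N) F :=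
  Matrix.of fun a b => if a = σ b then t b else 0

theorem monomialMatrix_mul_apply {σ : Equiv.Perm (Fin N)} (hσ : ∀ a, σ (σ a) = a) (t : Fin N → F)
    (M : Matrix (Fin N) (Fin N) F) (a b : Fin N) :
    (monomialMatrix σ t * M) a b = t (σ a) * M (σ a) b := by
  rw [Matrix.mul_apply, Finset.sum_eq_single (σ a)]
  · simp [monomialMatrix, hσ]
  · intro c _ hc
    have : a ≠ σ c := fun h => hc (by rw [h, hσ])
    simp [monomialMatrix, this]
  · simp

theorem mul_monomialMatrix_apply (σ : Equiv.Perm (Fin N)) (t : Fin N → F)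
    (M : Matrix (Fin N) (Fin N) F) (a b : Fin N) :
    (M * monomialMatrix σ t) a b = M a (σ b) * t b := by
  rw [Matrix.mul_apply, Finset.sum_eq_single (σ b)]
  · simp [monomialMatrix]
  · intro c _ hc
    simp [monomialMatrix, hc]
  · simp

variable (F) in
/-- The scalars of the reflection matrix. -/
def reflScalar (i j : Fin N) (m : ℤ) (b : Fin N) : Fˣ :=
  unif F ^ (if b = j then m else if b = i then -m else 0)

theorem ord_reflScalar (i j : Fin N) (m : ℤ) (b : Fin N) :
    ord (reflScalar F i j m b) = if b = j then m else if b = i then -m else 0 :=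
  ord_unif_zpow _

theorem reflScalar_swap {i j : Fin N} (hij : i ≠ j) (m : ℤ) (b : Fin N) :
    reflScalar F i j m (Equiv.swap i j b) = (reflScalar F i j m b)⁻¹ := by
  rw [reflScalar, reflScalar, ← zpow_neg]
  congr 1
  by_cases hj : b = j
  · subst hj
    simp [hij]
  by_cases hi : b = i
  · subst hi
    simp [hij]
  · simp [Equiv.swap_apply_of_ne_of_ne hi hj, hi, hj]

variable (F) in
/-- The matrix that exchanges `e i` and `e j`, up to powers of the uniformizer. -/
def reflMatrix (i j : Fin N) (m : ℤ) : Matrix (Fin N) (Fin N) F :=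
  monomialMatrix (Equiv.swap i j) fun b => (reflScalar F i j m b : F)

theorem reflMatrix_mul_self {i j : Fin N} (hij : i ≠ j) (m : ℤ) :
    reflMatrix F i j m * reflMatrix F i j m = 1 := by
  ext a b
  rw [reflMatrix, monomialMatrix_mul_apply (Equiv.swap_apply_self i j), reflScalar_swap hij]
  by_cases hab : a = b
  · subst hab
    simp [monomialMatrix]
  · simp [monomialMatrix, hab]

variable (F) in
/-- The matrix `reflMatrix`, as an element of the general linear group. -/
def reflGL {i j : Fin N} (hij : i ≠ j) (m : ℤ) : GL (Fin N) F :=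
  ⟨reflMatrix F i j m, reflMatrix F i j m, reflMatrix_mul_self hij m, reflMatrix_mul_self hij m⟩

theorem reflGL_inv {i j : Fin N} (hij : i ≠ j) (m : ℤ) : (reflGL F hij m)⁻¹ = reflGL F hij m :=
  Units.ext rfl

theorem reflGL_mul_self {i j : Fin N} (hij : i ≠ j) (m : ℤ) :
    reflGL F hij m * reflGL F hij m = 1 := Units.ext (reflMatrix_mul_self hij m)

/-- Conjugation by the reflection turns the bounds for `pos` into those for `swapPos pos i j`. The
double coset property is one step of elimination: the bounds of the swapped chamber fall short of
those of `pos` only at `(i, j)`, and when that entry violates its bound its order is exactly `m`, so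
it can serve as a pivot. -/
theorem isReflection_reflGL {pos : Fin N → ℤ} {i j : Fin N} {m : ℤ} (h : IsSucc pos i j m) :
    IsReflection (posIwahori F (swapPos pos i j)) (posIwahori F pos) (reflGL F h.ne m) := by
  have hdet : intVal (reflMatrix F i j m).det ^ 2 = 1 := by
    rw [← map_pow, sq, ← Matrix.det_mul, reflMatrix_mul_self h.ne, Matrix.det_one, map_one]
  have hdet1 : intVal (reflMatrix F i j m).det = 1 := by
    exact (pow_eq_one_iff.mp hdet).resolve_right two_ne_zero
  have happly : ∀ (g : Matrix (Fin N) (Fin N) F) (a b : Fin N),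
      (reflMatrix F i j m * g * reflMatrix F i j m) a b = ((reflScalar F i j m a)⁻¹ : Fˣ) *
        g (Equiv.swap i j a) (Equiv.swap i j b) * reflScalar F i j m b := by
    intro g a b
    rw [reflMatrix, mul_monomialMatrix_apply,
      monomialMatrix_mul_apply (Equiv.swap_apply_self i j), reflScalar_swap h.ne]
  have hgap : ∀ a b, gap (swapPos pos i j) a b = gap pos (Equiv.swap i j a) (Equiv.swap i j b) +
      ord (reflScalar F i j m b) - ord (reflScalar F i j m a) := by
    intro a b
    obtain ⟨h1, h2⟩ := gap_eq_iff.mp (rfl : gap pos (Equiv.swap i j a) (Equiv.swap i j b) = _)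
    rw [gap_eq_iff, h.swap_eq, h.swap_eq, ← ord_reflScalar (F := F), ← ord_reflScalar (F := F),
      sub_mul, add_mul]
    omega
  have hcancel : ∀ (n : ℤ) (x : F) (y z : Fˣ),
      OrdGe n (((y⁻¹ : Fˣ) : F) * x * z) ↔ OrdGe (n + ord y - ord z) x := by
    intro n x y z
    by_cases hx : x = 0
    · subst hx
      simp [ordGe_zero]
    obtain ⟨u, rfl⟩ : ∃ u : Fˣ, x = u := ⟨Units.mk0 x hx, rfl⟩
    rw [← Units.val_mul, ← Units.val_mul, ordGe_unit, ordGe_unit,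
      ord_mul, ord_mul, ord_inv]
    omega
  have hentry : ∀ (g : Matrix (Fin N) (Fin N) F) (a b : Fin N),
      OrdGe (gap pos a b) ((reflMatrix F i j m * g * reflMatrix F i j m) a b) ↔
        OrdGe (gap (swapPos pos i j) (Equiv.swap i j a) (Equiv.swap i j b))
          (g (Equiv.swap i j a) (Equiv.swap i j b)) := by
    intro g a b
    rw [happly, hcancel, hgap, Equiv.swap_apply_self, Equiv.swap_apply_self, reflScalar_swap h.ne,
      reflScalar_swap h.ne, ord_inv, ord_inv]
    exact iff_of_eq (congrArg (OrdGe · _) (by ring))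
  have hmem : ∀ g : GL (Fin N) F, g ∈ posIwahori F (swapPos pos i j) ↔
      reflGL F h.ne m * g * reflGL F h.ne m ∈ posIwahori F pos := by
    intro g
    rw [mem_posIwahori, mem_posIwahori]
    refine and_congr ?_ ⟨fun hg a b => (hentry _ a b).mpr (hg _ _), fun hg a b => ?_⟩
    · simp [reflGL, hdet1]
    · have := (hentry _ (Equiv.swap i j a) (Equiv.swap i j b)).mp (hg _ _)
      simpa using this
  have hgap_le : ∀ b, b ≠ i → gap (swapPos pos i j) i b - m ≥ gap pos j b := by
    intro b hi
    by_cases hj : b = j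
    · subst hj
      rw [h.gap_swap_left_right, gap_self]
      omega
    · rw [h.gap_swap_left hi hj, h.gap_left hj]
      omega
  constructor
  · rw [reflGL_mul_self]
    exact one_mem _
  · rw [reflGL_inv]
    exact hmem
  · intro x hx
    set s := reflGL F h.ne m with hs
    set y : GL (Fin N) F := s * x * s with hy
    have hss : s * s = 1 := reflGL_mul_self h.ne m
    have hyI : y ∈ posIwahori F (swapPos pos i j) := by
      rw [hmem, hy]
      have : s * (s * x * s) * s = x := by
        rw [show s * (s * x * s) * s = (s * s) * x * (s * s) by group, hss, one_mul, mul_one]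
      rwa [this]
    set Y : Matrix (Fin N) (Fin N) F := (y : Matrix (Fin N) (Fin N) F) with hY
    by_cases hij : OrdGe (gap pos i j) (Y i j)
    · left
      refine ⟨hyI.1, fun a b => ?_⟩
      by_cases h1 : a = i ∧ b = j
      · obtain ⟨rfl, rfl⟩ := h1
        exact hij
      by_cases h2 : a = j ∧ b = i
      · obtain ⟨rfl, rfl⟩ := h2
        refine (hyI.2 a b).mono ?_
        rw [h.gap_swap_right_left, h.gap_right_left]
        omega
      · rw [← h.gap_swap_of_ne h1 h2]
        exact hyI.2 a b
    · right
      obtain ⟨z, hz, hz1⟩ := exists_unit_of_not_ordGe hij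
      have hz2 := hyI.2 i j
      rw [← hY, hz, ordGe_unit, h.gap_swap_left_right] at hz2
      rw [h.gap_left_right] at hz1
      -- Adding `c` times row `i` to row `j` kills the entry `(j, j)`, which `s` then moves to `(i,
      -- j)`. As the pivot has order `m`, the multiplier has order at least `-m = gap pos j i`, so
      -- the row operation belongs to the group of `pos`.
      set c : F := -(Y j j) * (z⁻¹ : Fˣ) with hc
      have hcm : OrdGe (-m) c := by
        have h1 := (hyI.2 j j).neg
        rw [gap_self] at h1
        refine (h1.mul (ordGe_unit.mpr (le_refl (ord z⁻¹)))).mono ?_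
        rw [ord_inv]
        omega
      set C : Fin N → F := Pi.single j c with hC
      have hCi : C i = 0 := Pi.single_eq_of_ne h.ne _
      have hu : columnGL i C hCi ∈ posIwahori F pos := by
        refine columnGL_mem hCi fun k => ?_
        by_cases hk : k = j
        · subst hk
          rw [hC, Pi.single_eq_same, h.gap_right_left]
          exact hcm
        · rw [hC, Pi.single_eq_of_ne hk]
          exact ordGe_zero _
      refine ⟨(columnGL i C hCi)⁻¹, inv_mem hu, s * (columnGL i C hCi * y), ⟨?_, ?_⟩, ?_⟩
      · have h1 : intVal (s : Matrix (Fin N) (Fin N) F).det = 1 := hdet1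
        have h2 := hu.1
        have h3 := hyI.1
        simp only [Units.val_mul, Matrix.det_mul, map_mul, h1, h2, h3, mul_one]
      · intro a b
        have h1 : ((s * (columnGL i C hCi * y) : GL (Fin N) F) : Matrix (Fin N) (Fin N) F) a b =
            ((reflScalar F i j m a)⁻¹ : Fˣ) *
              (Y (Equiv.swap i j a) b + C (Equiv.swap i j a) * Y i b) * (1 : Fˣ) := by
          rw [Units.val_mul, Units.val_mul, coe_columnGL, hs]
          change (reflMatrix F i j m * (columnMatrix i C * Y)) a b = _
          rw [reflMatrix, monomialMatrix_mul_apply (Equiv.swap_apply_self i j),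
            columnMatrix_mul_apply, reflScalar_swap h.ne, Units.val_one,
            mul_one]
        rw [h1, hcancel, ord_one, sub_zero, ord_reflScalar]
        by_cases haj : a = j
        · subst haj
          rw [if_pos rfl, Equiv.swap_apply_right, hCi, zero_mul, add_zero]
          refine (hyI.2 i b).mono ?_
          by_cases hb : b = i
          · subst hb
            rw [gap_self, h.gap_right_left]
            omega
          · have := hgap_le b hb
            omega
        by_cases hai : a = i
        · subst hai
          rw [if_neg h.ne, if_pos rfl, Equiv.swap_apply_left, hC, Pi.single_eq_same]
          by_cases hb : b = j
          · subst hb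
            rw [hz, hc, mul_assoc, Units.inv_mul, mul_one, add_neg_cancel]
            exact ordGe_zero _
          · refine ((hyI.2 j b).mono ?_).add ((hcm.mul (hyI.2 a b)).mono ?_)
            · by_cases hba : b = a
              · subst hba
                rw [gap_self, h.gap_swap_right_left]
                omega
              · rw [h.gap_swap_right hba hb, h.gap_left hb]
                omega
            · by_cases hba : b = a
              · subst hba
                rw [gap_self, gap_self]
                omega
              · rw [h.gap_swap_left hba hb]
                omega
        · rw [if_neg haj, if_neg hai, Equiv.swap_apply_of_ne_of_ne hai haj, hC,
            Pi.single_eq_of_ne haj, zero_mul, add_zero, add_zero]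
          rw [← h.gap_swap_of_ne (by tauto) (by tauto)]
          exact hyI.2 a b
      · rw [show (columnGL i C hCi)⁻¹ * s * (s * (columnGL i C hCi * y)) =
          (columnGL i C hCi)⁻¹ * (s * s) * (columnGL i C hCi * y) by group, hss]
        group

end Matrices

/-! ### Galleries: walls that separate two chambers -/

section Gallery

variable {N : ℕ} [NeZero N]

/-- Every integer is the position of exactly one multiple of a basis vector. -/
theorem IsRegular.exists_eq {p : Fin N → ℤ} (hp : IsRegular p) (k : ℤ) :
    ∃ i : Fin N, ∃ m : ℤ, k = p i + m * N := by
  have hN : (0 : ℤ) < N := by exact_mod_cast NeZero.pos N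
  have hlt : ∀ k : ℤ, (k % N).toNat < N := fun k => by
    have := Int.emod_lt_of_pos k hN
    omega
  let f : Fin N → Fin N := fun i => ⟨(p i % N).toNat, hlt _⟩
  have hf : Function.Injective f := by
    intro i j hij
    have h1 : (p i % N).toNat = (p j % N).toNat := congrArg Fin.val hij
    have h2 := Int.emod_nonneg (p i) hN.ne'
    have h3 := Int.emod_nonneg (p j) hN.ne'
    have h4 : p i % N = p j % N := by omega
    obtain ⟨m, hm⟩ := Int.dvd_of_emod_eq_zero (Int.emod_eq_emod_iff_emod_sub_eq_zero.mp h4.symm)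
    exact hp i j m (by rw [hm, mul_comm])
  obtain ⟨i, hi⟩ := (Finite.injective_iff_surjective.mp hf) ⟨(k % N).toNat, hlt _⟩
  have h1 : (p i % N).toNat = (k % N).toNat := congrArg Fin.val hi
  have h2 := Int.emod_nonneg (p i) hN.ne'
  have h3 := Int.emod_nonneg k hN.ne'
  have h4 : k % N = p i % N := by omega
  obtain ⟨m, hm⟩ := Int.dvd_of_emod_eq_zero (Int.emod_eq_emod_iff_emod_sub_eq_zero.mp h4)
  exact ⟨i, m, by linarith [mul_comm m (N : ℤ)]⟩

theorem IsRegular.eq_of_eq {p : Fin N → ℤ} (hp : IsRegular p) {i j : Fin N} {m n : ℤ}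
    (h : p i + m * N = p j + n * N) : i = j ∧ m = n := by
  have hN : (0 : ℤ) < N := by exact_mod_cast NeZero.pos N
  obtain rfl := hp i j (m - n) (by rw [sub_mul]; linarith)
  exact ⟨rfl, mul_right_cancel₀ hN.ne' (by linarith)⟩

/-- If the chambers of `p` and `q` are different, then they are separated by a wall of the
chamber of `p`. -/
theorem exists_isSucc_of_gap_ne {p q : Fin N → ℤ} (hp : IsRegular p) (hpq : gap p ≠ gap q) :
    ∃ i j m, IsSucc p i j m ∧ gap q i j < gap p i j := by
  have hN : (0 : ℤ) < N := by exact_mod_cast NeZero.pos N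
  by_contra! hcon
  apply hpq
  choose I M hIM using hp.exists_eq
  -- `τ` sends the position under `p` of a vector `w ^ m e i` to its position under `q`. If no wall
  -- of `p` separates the chambers, `τ` increases at every step, so both orders agree and the gaps
  -- coincide.
  set τ : ℤ → ℤ := fun k => q (I k) + M k * N with hτ
  have hτp : ∀ i m, τ (p i + m * N) = q i + m * N := by
    intro i m
    obtain ⟨h1, h2⟩ := hp.eq_of_eq (hIM (p i + m * N))
    rw [hτ]
    simp only [← h1, ← h2]
  have hmono : StrictMono τ := by
    refine strictMono_int_of_lt_succ fun k => ?_
    have h1 := hIM k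
    have h2 := hIM (k + 1)
    simp only [hτ]
    by_cases hij : I k = I (k + 1)
    · rw [← hij] at h2 ⊢
      linarith
    · have hs : IsSucc p (I k) (I (k + 1)) (M k - M (k + 1)) :=
        ⟨hp, hij, by rw [sub_mul]; linarith⟩
      have h3 := hcon _ _ _ hs
      rw [hs.gap_left_right] at h3
      have h4 := gap_mul_lt q (I k) (I (k + 1))
      have h5 : (M k - M (k + 1)) * (N : ℤ) ≤ (gap q (I k) (I (k + 1)) - 1) * N :=
        mul_le_mul_of_nonneg_right (by omega) hN.le
      rw [sub_mul] at h5
      linarith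
  funext i j
  refine eq_of_forall_ge_iff fun k => ?_
  rw [gap_le_iff, gap_le_iff]
  have h1 : p j ≤ p i + k * N ↔ q j ≤ q i + k * N := by
    have h2 := hτp j 0
    rw [zero_mul, add_zero, add_zero] at h2
    rw [← hτp i k, ← h2, hmono.le_iff_le]
  constructor <;> intro h
  · linarith [h1.mp (by linarith)]
  · linarith [h1.mpr (by linarith)]

/-- A measure for the distance of two chambers. -/
def gapDist (p q : Fin N → ℤ) : ℕ := ∑ i, ∑ j, (gap p i j - gap q i j).natAbs

/-- Crossing the wall moves exactly two gaps, each by one and each towards its value for `q`. -/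
theorem IsSucc.gapDist_lt {p q : Fin N → ℤ} {i j : Fin N} {m : ℤ} (h : IsSucc p i j m)
    (hq : IsRegular q) (hlt : gap q i j < gap p i j) :
    gapDist (swapPos p i j) q < gapDist p q := by
  have h1 := h.gap_left_right
  have h2 := h.gap_right_left
  have h3 := h.gap_swap_left_right
  have h4 := h.gap_swap_right_left
  have h5 := gap_add_gap hq h.ne
  have hle : ∀ a b, (gap (swapPos p i j) a b - gap q a b).natAbs ≤
      (gap p a b - gap q a b).natAbs := by
    intro a b
    by_cases hab : a = i ∧ b = j
    · obtain ⟨rfl, rfl⟩ := hab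
      omega
    by_cases hba : a = j ∧ b = i
    · obtain ⟨rfl, rfl⟩ := hba
      omega
    · rw [h.gap_swap_of_ne hab hba]
  refine Finset.sum_lt_sum (fun a _ => Finset.sum_le_sum fun b _ => hle a b)
    ⟨i, Finset.mem_univ i, Finset.sum_lt_sum (fun b _ => hle i b) ⟨j, Finset.mem_univ j, ?_⟩⟩
  omega

/-- This is the hypothesis of `exists_factorization` for the chamber across the wall. The only gap
that decreases is the one at `(i, j)`, and separation keeps it at least `gap q i j`. -/
theorem IsSucc.min_gap_le {p q : Fin N → ℤ} {i j : Fin N} {m : ℤ} (h : IsSucc p i j m)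
    (hlt : gap q i j < gap p i j) (a b : Fin N) :
    min (gap q a b) (gap p a b) ≤ gap (swapPos p i j) a b := by
  have h1 := h.gap_left_right
  have h2 := h.gap_right_left
  have h3 := h.gap_swap_left_right
  have h4 := h.gap_swap_right_left
  by_cases hab : a = i ∧ b = j
  · obtain ⟨rfl, rfl⟩ := hab
    omega
  by_cases hba : a = j ∧ b = i
  · obtain ⟨rfl, rfl⟩ := hba
    omega
  · rw [h.gap_swap_of_ne hab hba]
    exact min_le_right _ _

end Gallery

/-! ### Transport to an arbitrary basis and induction along galleries -/

section Frame

variable {F : Type*} [Field F] [ValuativeRel F] [TopologicalSpace F]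
  [IsNonarchimedeanLocalField F] {N : ℕ} [NeZero N]

/-- The Iwahori subgroup attached to a vector of positions and to the basis formed by the columns
of `b`. -/
def frameIwahori (b : GL (Fin N) F) (pos : Fin N → ℤ) : Subgroup (GL (Fin N) F) :=
  (posIwahori F pos).comap (MulAut.conj b⁻¹).toMonoidHom

theorem mem_frameIwahori {b g : GL (Fin N) F} {pos : Fin N → ℤ} :
    g ∈ frameIwahori b pos ↔ b⁻¹ * g * b ∈ posIwahori F pos := by
  simp [frameIwahori]

theorem frameIwahori_congr (b : GL (Fin N) F) {p q : Fin N → ℤ} (h : gap p = gap q) :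
    frameIwahori b p = frameIwahori b q := by
  ext g
  rw [mem_frameIwahori, mem_frameIwahori, mem_posIwahori, mem_posIwahori, PosBound, PosBound, h]

theorem isCompactOpen_frameIwahori (b : GL (Fin N) F) (pos : Fin N → ℤ) :
    IsCompactOpen (frameIwahori b pos) := by
  have h := isCompactOpen_posIwahori (F := F) pos
  let c : GL (Fin N) F ≃ₜ GL (Fin N) F :=
    (Homeomorph.mulLeft b⁻¹).trans (Homeomorph.mulRight b)
  have hpre : (frameIwahori b pos : Set (GL (Fin N) F)) = c ⁻¹' (posIwahori F pos) := by
    ext g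
    exact mem_frameIwahori
  constructor
  · rw [hpre]
    exact h.isOpen.preimage c.continuous
  · rw [hpre]
    exact c.isCompact_preimage.mpr h.isCompact

theorem exists_frame_factorization (b : GL (Fin N) F) {p q r : Fin N → ℤ} (hp : IsRegular p)
    (h : ∀ i j, i ≠ j → min (gap q i j) (gap r i j) ≤ gap p i j) :
    ∀ k ∈ frameIwahori b p, ∃ x ∈ frameIwahori b q, ∃ y ∈ frameIwahori b r, k = x * y := by
  intro k hk
  obtain ⟨x, hx, y, hy, hxy⟩ := exists_factorization hp h (mem_frameIwahori.mp hk)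
  refine ⟨b * x * b⁻¹, mem_frameIwahori.mpr ?_, b * y * b⁻¹, mem_frameIwahori.mpr ?_, ?_⟩
  · simpa [mul_assoc] using hx
  · simpa [mul_assoc] using hy
  · rw [show b * x * b⁻¹ * (b * y * b⁻¹) = b * (x * y) * b⁻¹ by group, ← hxy]
    group

theorem isReflection_frame (b : GL (Fin N) F) {pos : Fin N → ℤ} {i j : Fin N} {m : ℤ}
    (h : IsSucc pos i j m) : IsReflection (frameIwahori b (swapPos pos i j)) (frameIwahori b pos)
      (b * reflGL F h.ne m * b⁻¹) := by
  have hs := isReflection_reflGL (F := F) h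
  set s := reflGL F h.ne m
  constructor
  · rw [mem_frameIwahori]
    simpa [mul_assoc] using hs.sq_mem
  · intro g
    rw [mem_frameIwahori, mem_frameIwahori, hs.mem_iff]
    simp [mul_assoc]
  · intro x hx
    obtain h | ⟨u, hu, v, hv, huv⟩ := hs.double_coset _ (mem_frameIwahori.mp hx)
    · left
      rw [mem_frameIwahori]
      simpa [mul_assoc] using h
    · refine Or.inr ⟨b * u * b⁻¹, mem_frameIwahori.mpr ?_, b * v * b⁻¹, mem_frameIwahori.mpr ?_, ?_⟩
      · simpa [mul_assoc] using hu
      · simpa [mul_assoc] using hv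
      · rw [show b * u * b⁻¹ * (b * s * b⁻¹) * (b * v * b⁻¹) = b * (u * s * v) * b⁻¹ by group, ← huv]
        group

variable [MeasurableSpace (GL (Fin N) F)] [BorelSpace (GL (Fin N) F)]
  (μ : Measure (GL (Fin N) F)) [μ.IsHaarMeasure]
  {W : Type*} [AddCommGroup W] [Module ℂ W] {ρ : Representation ℂ (GL (Fin N) F) W}
  (hρ : IsSmooth ρ) (b : GL (Fin N) F)

/-- The operator `e_I` is bijective from the vectors fixed by `J` to those fixed by `I`, for two
Iwahori subgroups `I` and `J` attached to chambers in the same apartment. -/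
theorem bijOn_heckeProj {q : Fin N → ℤ} (hq : IsRegular q) {p : Fin N → ℤ} (hp : IsRegular p) :
    Set.BijOn (heckeProj μ hρ (isCompactOpen_frameIwahori b q))
      (fixedVectors ρ (frameIwahori b p) : Set W) (fixedVectors ρ (frameIwahori b q) : Set W) := by
  induction hn : gapDist p q using Nat.strong_induction_on generalizing p with
  | _ n ih =>
    by_cases hpq : gap p = gap q
    · rw [frameIwahori_congr b hpq]
      exact (Set.bijOn_id _).congr fun v hv => (heckeProj_of_mem μ hρ _ hv).symm
    · obtain ⟨i, j, m, h, hlt⟩ := exists_isSucc_of_gap_ne hp hpq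
      -- With `K` the group of the neighbour across the wall, `e_K` is bijective by the reflection
      -- and `e_I` on the vectors fixed by `K` by induction; the composite is `e_I` because `K ⊆ I
      -- J`.
      have h1 := ih _ (hn ▸ h.gapDist_lt hq hlt) h.regular_swap rfl
      have h2 := (isReflection_frame b h).bijective μ hρ
        (isCompactOpen_frameIwahori b (swapPos p i j)) (isCompactOpen_frameIwahori b p)
      refine (h1.comp h2).congr fun v hv => ?_
      exact heckeProj_heckeProj_of_factor μ hρ (isCompactOpen_frameIwahori b q)
        (isCompactOpen_frameIwahori b (swapPos p i j))
        (exists_frame_factorization b h.regular_swap fun a c _ => h.min_gap_le hlt a c) hv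

end Frame

/-! ### Chambers of the apartment as chains of lattices -/

section Lattices

variable {F : Type*} [Field F] [ValuativeRel F] [TopologicalSpace F]
  [IsNonarchimedeanLocalField F] {N : ℕ} (e : Module.Basis (Fin N) F (Fin N → F))

theorem mem_frameLattice {t : Fin N → Fˣ} {v : Fin N → F} :
    v ∈ frameLattice e t ↔ ∀ i, OrdGe (ord (t i)) (e.repr v i) := by
  constructor
  · intro hv
    refine Submodule.span_induction (fun x hx i => ?_) (fun i => ?_) (fun x y _ _ hx hy i => ?_)
      (fun a x _ hx i => ?_) hv
    · obtain ⟨j, rfl⟩ := hx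
      simp only [map_smul, Module.Basis.repr_self, Finsupp.smul_single, smul_eq_mul, mul_one]
      by_cases hij : j = i
      · subst hij
        rw [Finsupp.single_eq_same, ordGe_unit]
      · rw [Finsupp.single_eq_of_ne (Ne.symm hij)]
        exact ordGe_zero _
    · rw [map_zero]
      exact ordGe_zero _
    · rw [map_add]
      exact (hx i).add (hy i)
    · have h1 : a • x = (a : F) • x := rfl
      rw [h1, map_smul, Finsupp.smul_apply, smul_eq_mul]
      exact ((mem_integer_iff.mp a.2).mul (hx i)).mono (by omega)
  · intro h
    rw [← e.sum_repr v]
    refine Submodule.sum_mem _ fun i _ => ?_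
    have h1 : OrdGe 0 (e.repr v i * ((t i)⁻¹ : Fˣ)) := by
      refine ((h i).mul (ordGe_unit.mpr (le_refl (ord (t i)⁻¹)))).mono ?_
      rw [ord_inv]
      omega
    have h2 : e.repr v i • e i =
        (⟨e.repr v i * ((t i)⁻¹ : Fˣ), mem_integer_iff.mpr h1⟩ : 𝒪[F]) • ((t i : F) • e i) := by
      change _ = (e.repr v i * ((t i)⁻¹ : Fˣ) : F) • ((t i : F) • e i)
      rw [smul_smul, mul_assoc, Units.inv_mul, mul_one]
    rw [h2]
    exact Submodule.smul_mem _ _ (Submodule.subset_span ⟨i, rfl⟩)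

theorem frameLattice_le_iff {s t : Fin N → Fˣ} :
    frameLattice e t ≤ frameLattice e s ↔ ∀ i, ord (s i) ≤ ord (t i) := by
  constructor
  · intro h i
    have h1 : (t i : F) • e i ∈ frameLattice e s := h (Submodule.subset_span ⟨i, rfl⟩)
    have h2 := (mem_frameLattice e).mp h1 i
    simpa [ordGe_unit] using h2
  · intro h v hv
    rw [mem_frameLattice] at hv ⊢
    exact fun i => (hv i).mono (h i)

theorem frameLattice_eq_iff {s t : Fin N → Fˣ} :
    frameLattice e t = frameLattice e s ↔ ∀ i, ord (t i) = ord (s i) := by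
  rw [le_antisymm_iff, frameLattice_le_iff, frameLattice_le_iff, ← forall_and]
  exact forall_congr' fun i => by rw [and_comm, le_antisymm_iff]

theorem homothety_frameLattice (c : Fˣ) (t : Fin N → Fˣ) :
    homothety c (frameLattice e t) = frameLattice e fun i => c * t i := by
  rw [homothety, frameLattice, frameLattice, Submodule.map_span, ← Set.range_comp]
  congr 2
  funext i
  simp [smul_smul, mul_comm]

theorem isLattice_frameLattice (t : Fin N → Fˣ) : Submodule.IsLattice F (frameLattice e t) where
  fg := Submodule.fg_span (Set.finite_range _)
  span_eq_top := by
    rw [eq_top_iff, ← e.span_eq, Submodule.span_le]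
    rintro _ ⟨i, rfl⟩
    have h1 : (t i : F) • e i ∈ Submodule.span F (frameLattice e t : Set (Fin N → F)) :=
      Submodule.subset_span (Submodule.subset_span ⟨i, rfl⟩)
    have h2 := Submodule.smul_mem _ ((t i)⁻¹ : Fˣ).val h1
    rwa [smul_smul, Units.inv_mul, one_smul] at h2

/-- The exponent of the `i`-th basis vector in the lattice spanned by the vectors of position at
least `k`. -/
def expo (pos : Fin N → ℤ) (k : ℤ) (i : Fin N) : ℤ := -((pos i - k) / N)

/-- The lattice spanned by the multiples `w ^ m e i` of position at least `k`, where `w` is a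
uniformizer and the position is `pos i + m N`. -/
def posLattice (pos : Fin N → ℤ) (k : ℤ) : Submodule 𝒪[F] (Fin N → F) :=
  frameLattice e fun i => unif F ^ expo pos k i

/-- The chain of the lattices `posLattice e pos k`. -/
def posChain (pos : Fin N → ℤ) : Set (Submodule 𝒪[F] (Fin N → F)) :=
  Set.range (posLattice e pos)

variable [NeZero N] {pos : Fin N → ℤ}

theorem expo_le_iff {k m : ℤ} {i : Fin N} : expo pos k i ≤ m ↔ k - pos i ≤ m * N := by
  have hN : (0 : ℤ) < N := by exact_mod_cast NeZero.pos N
  rw [expo, neg_le, Int.le_ediv_iff_mul_le hN]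
  constructor <;> intro h <;> linarith

theorem expo_eq_iff {k m : ℤ} {i : Fin N} :
    expo pos k i = m ↔ k - pos i ≤ m * N ∧ m * N < k - pos i + N := by
  have h1 := expo_le_iff (pos := pos) (i := i) (k := k) (m := m)
  have h2 := expo_le_iff (pos := pos) (i := i) (k := k) (m := m - 1)
  rw [sub_mul, one_mul] at h2
  omega

theorem expo_self (i j : Fin N) : expo pos (pos j) i = gap pos i j := rfl

theorem expo_add (k m : ℤ) (i : Fin N) : expo pos (k + m * N) i = expo pos k i + m := by
  obtain ⟨h1, h2⟩ := expo_eq_iff.mp (rfl : expo pos k i = _)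
  rw [expo_eq_iff, add_mul]
  constructor <;> linarith

theorem expo_le_add (k : ℤ) (i j : Fin N) : expo pos k i ≤ gap pos i j + expo pos k j := by
  rw [expo_le_iff, add_mul]
  have h1 := le_gap_mul pos i j
  have h2 := (expo_le_iff (pos := pos) (k := k) (i := j)).mp le_rfl
  linarith

theorem mem_posLattice {k : ℤ} {v : Fin N → F} :
    v ∈ posLattice e pos k ↔ ∀ i, OrdGe (expo pos k i) (e.repr v i) := by
  simp only [posLattice, mem_frameLattice, ord_unif_zpow]

theorem frameLattice_eq_posLattice_iff {t : Fin N → Fˣ} {k : ℤ} :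
    frameLattice e t = posLattice e pos k ↔ ∀ i, ord (t i) = expo pos k i := by
  simp only [posLattice, frameLattice_eq_iff, ord_unif_zpow]

theorem posLattice_eq_posLattice_iff {p q : Fin N → ℤ} {k l : ℤ} :
    posLattice e p k = posLattice e q l ↔ ∀ i, expo p k i = expo q l i := by
  rw [posLattice, frameLattice_eq_posLattice_iff]
  simp only [ord_unif_zpow]

theorem posLattice_antitone : Antitone (posLattice e pos) := by
  intro k l hkl
  rw [posLattice, posLattice, frameLattice_le_iff]
  intro i
  rw [ord_unif_zpow, ord_unif_zpow, expo_le_iff]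
  have := (expo_le_iff (pos := pos) (k := l) (i := i)).mp le_rfl
  omega

theorem posLattice_strictAnti (hpos : IsRegular pos) : StrictAnti (posLattice e pos) := by
  have hN : (0 : ℤ) < N := by exact_mod_cast NeZero.pos N
  refine (posLattice_antitone e).strictAnti_of_injective fun k l h => ?_
  rw [posLattice_eq_posLattice_iff] at h
  by_contra hne
  wlog hlt : k < l generalizing k l
  · exact this l k (fun i => (h i).symm) (Ne.symm hne) (by omega)
  obtain ⟨i, m, hm⟩ := hpos.exists_eq k
  have h1 : expo pos k i = m := expo_eq_iff.mpr (by omega)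
  have h2 := (expo_eq_iff.mp ((h i).symm.trans h1)).1
  omega

theorem homothety_posLattice (c : Fˣ) (k : ℤ) :
    homothety c (posLattice e pos k) = posLattice e pos (k + ord c * N) := by
  rw [posLattice, homothety_frameLattice, frameLattice_eq_posLattice_iff]
  intro i
  rw [ord_mul, ord_unif_zpow, expo_add, add_comm]

theorem isSimplex_posChain (pos : Fin N → ℤ) : IsSimplex (posChain e pos) where
  nonempty := Set.range_nonempty _
  isLattice := by
    rintro _ ⟨k, rfl⟩
    exact isLattice_frameLattice e _
  homothety_mem := by
    rintro _ ⟨k, rfl⟩ c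
    exact ⟨_, (homothety_posLattice e c k).symm⟩
  isChain := by
    rintro _ ⟨k, rfl⟩ _ ⟨l, rfl⟩ _
    obtain h | h := le_total k l
    · exact Or.inr (posLattice_antitone e h)
    · exact Or.inl (posLattice_antitone e h)

/-- A chain of subsets of `Fin N` consists of initial segments for a suitable order. -/
theorem exists_perm_of_isChain (S : Set (Finset (Fin N))) (hS : IsChain (· ⊆ ·) S) :
    ∃ σ : Equiv.Perm (Fin N), ∀ A ∈ S, ∀ i ∈ A, ∀ j ∉ A, σ i < σ j := by
  classical
  -- The weight counts the members that miss `i`. If `i ∈ A` and `j ∉ A`, every member missing `i`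
  -- lies inside `A` and misses `j`, while `A` misses only `j`; sorting by weight gives the order.
  set w : Fin N → ℕ := fun i => (Finset.univ.filter fun A => A ∈ S ∧ i ∉ A).card with hw
  refine ⟨(Tuple.sort w).symm, fun A hA i hi j hj => ?_⟩
  have hlt : w i < w j := by
    refine Finset.card_lt_card ⟨fun B hB => ?_, fun hsub => ?_⟩
    · simp only [Finset.mem_filter, Finset.mem_univ, true_and] at hB ⊢
      refine ⟨hB.1, fun hjB => ?_⟩
      obtain h | h := hS.total hA hB.1
      · exact hB.2 (h hi)
      · exact hj (h hjB)
    · have h1 : A ∈ Finset.univ.filter fun A => A ∈ S ∧ j ∉ A := by simp [hA, hj]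
      have h2 := hsub h1
      simp [hi] at h2
  by_contra! hle
  have h1 := Tuple.monotone_sort w hle
  simp only [Function.comp_apply, Equiv.apply_symm_apply] at h1
  omega

/-- Every chamber of the apartment is the chain of a vector of positions. -/
theorem exists_eq_posChain {C : Set (Submodule 𝒪[F] (Fin N → F))} (hC : IsChamber C)
    (hCe : C ⊆ apartment e) : ∃ pos, IsRegular pos ∧ C = posChain e pos := by
  classical
  have hN : (0 : ℤ) < N := by exact_mod_cast NeZero.pos N
  obtain ⟨L₀, hL₀⟩ := hC.prop.nonempty
  obtain ⟨t₀, rfl⟩ := hCe hL₀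
  -- Up to homothety, each lattice of `C` lies between `w L₀` and `L₀`, where `L₀` is the lattice of
  -- `t₀`, and corresponds to the set of indices where its exponent is one larger than that of `L₀`.
  set S : Set (Finset (Fin N)) := {A | ∃ t : Fin N → Fˣ, frameLattice e t ∈ C ∧
    ∀ i, ord (t i) = ord (t₀ i) + if i ∈ A then 1 else 0} with hSdef
  have hS : IsChain (· ⊆ ·) S := by
    rintro A ⟨s, hs, hsA⟩ B ⟨t, ht, htB⟩ _
    have key : ∀ {A B : Finset (Fin N)} {s t : Fin N → Fˣ},
        (∀ i, ord (s i) = ord (t₀ i) + if i ∈ A then 1 else 0) →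
        (∀ i, ord (t i) = ord (t₀ i) + if i ∈ B then 1 else 0) →
        frameLattice e t ≤ frameLattice e s → A ⊆ B := by
      intro A B s t hsA htB h i hi
      have h1 := (frameLattice_le_iff e).mp h i
      rw [hsA, htB, if_pos hi] at h1
      by_contra hiB
      rw [if_neg hiB] at h1
      omega
    obtain h | h := hC.prop.isChain.total hs ht
    · exact Or.inr (key htB hsA h)
    · exact Or.inl (key hsA htB h)
  obtain ⟨σ, hσ⟩ := exists_perm_of_isChain S hS
  have hσ0 : ∀ i, (0 : ℤ) ≤ ((σ i : ℕ) : ℤ) := fun i => by omega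
  have hσN : ∀ i, ((σ i : ℕ) : ℤ) < N := fun i => by exact_mod_cast (σ i).2
  -- The order `σ` supplies the residues modulo `N`, and the exponents of `L₀` the multiples of `N`;
  -- thus `L₀` is the lattice of positions at least 0.
  set pos : Fin N → ℤ := fun i => ((σ i : ℕ) : ℤ) - ord (t₀ i) * N with hpos
  have hreg : IsRegular pos := by
    intro i j m hm
    simp only [hpos] at hm
    have h1 : ((σ j : ℕ) : ℤ) - ((σ i : ℕ) : ℤ) = (m + ord (t₀ j) - ord (t₀ i)) * N := by
      rw [sub_mul, add_mul]
      linarith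
    have h2 : m + ord (t₀ j) - ord (t₀ i) = 0 := by
      have h3 := hσ0 i
      have h4 := hσN i
      have h5 := hσ0 j
      have h6 := hσN j
      by_contra hne
      obtain h | h := lt_or_gt_of_ne hne
      · nlinarith
      · nlinarith
    rw [h2, zero_mul] at h1
    exact σ.injective (Fin.ext (by omega))
  have hsub : C ⊆ posChain e pos := by
    intro L hL
    obtain ⟨t, rfl⟩ := hCe hL
    obtain ⟨i₁, -, hi₁⟩ := Finset.exists_min_image Finset.univ (fun i => ord (t i) - ord (t₀ i))
      Finset.univ_nonempty
    set m := ord (t i₁) - ord (t₀ i₁) with hm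
    have hge : ∀ i, ord (t₀ i) + m ≤ ord (t i) := fun i => by
      have := hi₁ i (Finset.mem_univ i)
      omega
    -- The lattice is comparable with `w ^ (m + 1) L₀`. It cannot be contained in it, since the
    -- minimal difference `m` is attained at `i₁`.
    have hle : ∀ i, ord (t i) ≤ ord (t₀ i) + m + 1 := by
      have h1 := hC.prop.homothety_mem _ hL₀ (unif F ^ (m + 1))
      rw [homothety_frameLattice] at h1
      obtain h2 | h2 := hC.prop.isChain.total hL h1
      · have h3 := (frameLattice_le_iff e).mp h2 i₁
        rw [ord_mul, ord_unif_zpow] at h3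
        omega
      · intro i
        have h3 := (frameLattice_le_iff e).mp h2 i
        rw [ord_mul, ord_unif_zpow] at h3
        omega
    set A : Finset (Fin N) := Finset.univ.filter fun i => ord (t i) = ord (t₀ i) + m + 1 with hA
    have hAS : A ∈ S := by
      have h1 := hC.prop.homothety_mem _ hL (unif F ^ (-m))
      rw [homothety_frameLattice] at h1
      refine ⟨_, h1, fun i => ?_⟩
      rw [ord_mul, ord_unif_zpow]
      have h2 := hge i
      have h3 := hle i
      by_cases hi : i ∈ A
      · rw [if_pos hi]
        simp only [hA, Finset.mem_filter, Finset.mem_univ, true_and] at hi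
        omega
      · rw [if_neg hi]
        simp only [hA, Finset.mem_filter, Finset.mem_univ, true_and] at hi
        omega
    -- `A` is the initial segment of the indices with `σ i < K`; if `A` is empty, the supremum is 0,
    -- as needed.
    set K : ℕ := A.sup fun i => (σ i : ℕ) + 1 with hK
    have hK1 : ∀ i ∈ A, (σ i : ℕ) < K := fun i hi =>
      Finset.le_sup (f := fun i => (σ i : ℕ) + 1) hi
    have hK2 : ∀ j ∉ A, K ≤ (σ j : ℕ) := fun j hj =>
      Finset.sup_le fun i hi => hσ A hAS i hi j hj
    have hK3 : K ≤ N := Finset.sup_le fun i _ => (σ i).2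
    refine ⟨K + m * N, Eq.symm ((frameLattice_eq_posLattice_iff e).mpr fun i => ?_)⟩
    rw [expo_add]
    have h2 := hge i
    have h3 := hle i
    have h4 := hσ0 i
    have h5 := hσN i
    by_cases hi : i ∈ A
    · have h6 := hK1 i hi
      simp only [hA, Finset.mem_filter, Finset.mem_univ, true_and] at hi
      have h7 : expo pos K i = ord (t₀ i) + 1 := by
        rw [expo_eq_iff, add_mul]
        simp only [hpos]
        omega
      omega
    · have h6 := hK2 i hi
      simp only [hA, Finset.mem_filter, Finset.mem_univ, true_and] at hi
      have h7 : expo pos K i = ord (t₀ i) := by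
        rw [expo_eq_iff]
        simp only [hpos]
        omega
      omega
  -- Maximality of the chamber turns the inclusion into an equality.
  exact ⟨pos, hreg, hsub.antisymm (hC.2 (isSimplex_posChain e pos) hsub)⟩

end Lattices

/-! ### The stabilizer of a chamber in terms of matrix entries -/

section Stabilizer

variable {F : Type*} [Field F] [ValuativeRel F] [TopologicalSpace F]
  [IsNonarchimedeanLocalField F] {N : ℕ} (e : Module.Basis (Fin N) F (Fin N → F))

/-- The matrix whose columns are the vectors of the basis `e`. -/
def frameMatrix : GL (Fin N) F where
  val := (Pi.basisFun F (Fin N)).toMatrix e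
  inv := e.toMatrix (Pi.basisFun F (Fin N))
  val_inv := Module.Basis.toMatrix_mul_toMatrix_flip _ _
  inv_val := Module.Basis.toMatrix_mul_toMatrix_flip _ _

/-- The entries in the basis `e` of the endomorphism given by a matrix. -/
theorem coe_conj_frameMatrix (g : GL (Fin N) F) :
    (((frameMatrix e)⁻¹ * g * frameMatrix e : GL (Fin N) F) : Matrix (Fin N) (Fin N) F) =
      LinearMap.toMatrix e e (Matrix.mulVecLin (g : Matrix (Fin N) (Fin N) F)) := by
  have h : LinearMap.toMatrix (Pi.basisFun F (Fin N)) (Pi.basisFun F (Fin N))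
      (Matrix.mulVecLin (g : Matrix (Fin N) (Fin N) F)) = g := by
    rw [LinearMap.toMatrix_eq_toMatrix', ← Matrix.toLin'_apply', LinearMap.toMatrix'_toLin']
  rw [← basis_toMatrix_mul_linearMap_toMatrix_mul_basis_toMatrix e (Pi.basisFun F (Fin N)) e
    (Pi.basisFun F (Fin N)), h]
  rfl

theorem repr_mulVec (g : GL (Fin N) F) (v : Fin N → F) (i : Fin N) :
    e.repr ((g : Matrix (Fin N) (Fin N) F) *ᵥ v) i =
      ∑ j, ((frameMatrix e)⁻¹ * g * frameMatrix e : GL (Fin N) F).val i j * e.repr v j := by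
  rw [coe_conj_frameMatrix, ← Matrix.mulVecLin_apply, ← LinearMap.toMatrix_mulVec_repr e e]
  rfl

theorem mem_latticeAct {g : GL (Fin N) F} {L : Submodule 𝒪[F] (Fin N → F)} {v : Fin N → F} :
    v ∈ latticeAct g L ↔ ∃ x ∈ L, (g : Matrix (Fin N) (Fin N) F) *ᵥ x = v := Iff.rfl

theorem latticeAct_inv_latticeAct (g : GL (Fin N) F) (L : Submodule 𝒪[F] (Fin N → F)) :
    latticeAct g⁻¹ (latticeAct g L) = L := by
  rw [← latticeAct_mul, inv_mul_cancel, latticeAct_one]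

theorem latticeAct_mono (g : GL (Fin N) F) : Monotone (latticeAct g) :=
  fun _ _ h => Submodule.map_mono h

theorem latticeAct_strictMono (g : GL (Fin N) F) : StrictMono (latticeAct g) :=
  (latticeAct_mono g).strictMono_of_injective
    (Function.LeftInverse.injective (latticeAct_inv_latticeAct g))

variable [NeZero N] {pos : Fin N → ℤ}

theorem latticeAct_posLattice_le {g : GL (Fin N) F} (hg : g ∈ frameIwahori (frameMatrix e) pos)
    (k : ℤ) : latticeAct g (posLattice e pos k) ≤ posLattice e pos k := by
  intro v hv
  obtain ⟨x, hx, rfl⟩ := mem_latticeAct.mp hv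
  rw [mem_posLattice] at hx ⊢
  intro i
  rw [repr_mulVec]
  exact ordGe_sum fun j _ => (((mem_frameIwahori.mp hg).2 i j).mul (hx j)).mono (expo_le_add k i j)

theorem latticeAct_posLattice {g : GL (Fin N) F} (hg : g ∈ frameIwahori (frameMatrix e) pos)
    (k : ℤ) : latticeAct g (posLattice e pos k) = posLattice e pos k := by
  refine (latticeAct_posLattice_le e hg k).antisymm ?_
  have h := latticeAct_mono g (latticeAct_posLattice_le e (inv_mem hg) k)
  rwa [← latticeAct_mul, mul_inv_cancel, latticeAct_one] at h

/-- The entries of an element that shifts the lattices in the chain by at least `c`. -/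
theorem ordGe_entry {g : GL (Fin N) F} {c : ℤ}
    (hg : ∀ k, latticeAct g (posLattice e pos k) ≤ posLattice e pos (k + c)) (i j : Fin N) :
    OrdGe (expo pos (pos j + c) i)
      (((frameMatrix e)⁻¹ * g * frameMatrix e : GL (Fin N) F).val i j) := by
  have h1 : e j ∈ posLattice e pos (pos j) := by
    rw [mem_posLattice]
    intro l
    rw [Module.Basis.repr_self]
    by_cases hl : l = j
    · subst hl
      rw [expo_self, gap_self, Finsupp.single_eq_same]
      exact ordGe_one
    · rw [Finsupp.single_eq_of_ne hl]
      exact ordGe_zero _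
  have h2 := (mem_posLattice e).mp (hg (pos j) (mem_latticeAct.mpr ⟨_, h1, rfl⟩)) i
  rw [repr_mulVec, Finset.sum_eq_single j] at h2
  · simpa using h2
  · intro l _ hl
    rw [Module.Basis.repr_self, Finsupp.single_eq_of_ne hl, mul_zero]
  · simp

theorem det_conj_frameMatrix (g : GL (Fin N) F) :
    ((frameMatrix e)⁻¹ * g * frameMatrix e : GL (Fin N) F).val.det = g.val.det := by
  rw [Units.val_mul, Units.val_mul, Matrix.det_mul, Matrix.det_mul, mul_right_comm,
    ← Matrix.det_mul, ← Units.val_mul, inv_mul_cancel, Units.val_one, Matrix.det_one, one_mul]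

/-- A shift by `c` adds `c` to each of the `N` column positions in the determinant bound, so the
order of the determinant is at least `c`. -/
theorem shift_nonpos {g : GL (Fin N) F} {c : ℤ} (hdet : intVal g.val.det = 1)
    (hg : ∀ k, latticeAct g (posLattice e pos k) ≤ posLattice e pos (k + c)) : c ≤ 0 := by
  have hN : (0 : ℤ) < N := by exact_mod_cast NeZero.pos N
  have h1 : ∀ i j, intVal (((frameMatrix e)⁻¹ * g * frameMatrix e : GL (Fin N) F).val i j) ^ N ≤
      WithZero.exp (pos i - (pos j + c)) :=
    fun i j => ordGe_ediv_iff.mp (ordGe_entry e hg i j)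
  have h2 := intVal_det_pow_le h1
  rw [det_conj_frameMatrix, hdet, one_pow, ← WithZero.exp_zero, WithZero.exp_le_exp,
    Finset.sum_add_distrib, Finset.sum_const, Finset.card_univ, Fintype.card_fin, nsmul_eq_mul] at h2
  by_contra! hc
  nlinarith

/-- The stabilizer of a chamber in the apartment, in terms of entries. -/
theorem iwahori_posChain (hpos : IsRegular pos) :
    iwahori (posChain e pos) = frameIwahori (frameMatrix e) pos := by
  ext g
  constructor
  · rintro ⟨hdet, hg⟩
    have hdet1 : intVal g.val.det = 1 := valuation_eq_one_iff.mp hdet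
    have hex : ∀ k, ∃ l, posLattice e pos l = latticeAct g (posLattice e pos k) := fun k => by
      have h : latticeAct g (posLattice e pos k) ∈ posChain e pos := by
        rw [← hg]
        exact ⟨_, ⟨k, rfl⟩, rfl⟩
      exact h
    choose φ hφ using hex
    have hanti := posLattice_strictAnti e hpos
    have hmono : StrictMono φ := fun k l hkl => by
      rw [← hanti.lt_iff_gt, hφ, hφ]
      exact latticeAct_strictMono g (hanti hkl)
    have hsurj : Function.Surjective φ := fun l => by
      have h : posLattice e pos l ∈ latticeAct g '' posChain e pos := by
        rw [hg]
        exact ⟨l, rfl⟩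
      obtain ⟨_, ⟨k, rfl⟩, hk⟩ := h
      exact ⟨k, hanti.injective (by rw [hφ, hk])⟩
    -- The chain is ordered like `ℤ`, so `g` acts on it by an order automorphism of `ℤ`, hence by a
    -- translation. Bounding the shift for `g` and for `g⁻¹` shows that it is zero.
    have hsucc : ∀ k, φ (k + 1) = φ k + 1 := fun k =>
      (hmono.orderIsoOfSurjective φ hsurj).map_succ k
    have hshift : ∀ k, φ k = k + φ 0 := by
      intro k
      induction k with
      | zero => omega
      | succ n ih => rw [hsucc]; omega
      | pred n ih =>
        have := hsucc (-n - 1)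
        rw [sub_add_cancel] at this
        omega
    have h1 := shift_nonpos e (g := g) (c := φ 0) hdet1 fun k => by rw [← hφ, hshift]
    have h2 := shift_nonpos e (pos := pos) (g := g⁻¹) (c := -φ 0) (by
      rw [Matrix.coe_units_inv, Matrix.det_nonsing_inv, Ring.inverse_eq_inv', map_inv₀, hdet1,
        inv_one]) fun k => by
      have h3 := hφ (k - φ 0)
      rw [hshift, sub_add_cancel] at h3
      rw [h3, latticeAct_inv_latticeAct, sub_eq_add_neg]
    have h3 : φ 0 = 0 := by omega
    rw [mem_frameIwahori]
    refine ⟨by rw [det_conj_frameMatrix, hdet1], fun i j => ?_⟩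
    have h4 := ordGe_entry e (g := g) (pos := pos) (c := 0)
      (fun k => by rw [← hφ, hshift, h3]) i j
    rwa [add_zero] at h4
  · intro hg
    refine ⟨valuation_eq_one_iff.mpr ?_, ?_⟩
    · have h1 := (mem_frameIwahori.mp hg).1
      rwa [det_conj_frameMatrix] at h1
    · rw [posChain, ← Set.range_comp]
      congr 1
      funext k
      exact latticeAct_posLattice e hg k

end Stabilizer

/-! ### Enclos and adjacency in terms of gaps -/

section Enclos

variable {F : Type*} [Field F] [ValuativeRel F] [TopologicalSpace F]
  [IsNonarchimedeanLocalField F] {N : ℕ} [NeZero N] (e : Module.Basis (Fin N) F (Fin N → F))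

theorem mem_halfApartment_posLattice {pos : Fin N → ℤ} {k : ℤ} {i j : Fin N} {c : Fˣ} :
    posLattice e pos k ∈ halfApartment e i j c ↔ expo pos k i ≤ ord c + expo pos k j := by
  constructor
  · rintro ⟨t, ht, hle⟩
    have h1 := (frameLattice_eq_posLattice_iff e).mp ht.symm
    rw [← Units.val_mul, vle_iff_ord_le, ord_mul, h1, h1] at hle
    exact hle
  · intro h
    refine ⟨_, rfl, ?_⟩
    rw [← Units.val_mul, vle_iff_ord_le, ord_mul, ord_unif_zpow, ord_unif_zpow]
    exact h

/-- The half-apartment whose constant has order `max (gap q i j) (gap r i j)` contains both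
chambers. Its condition at the lattice of `p` with index `p j` is the asserted bound, because there
the exponents differ by exactly `gap p i j`. -/
theorem gap_le_max_of_subset_enclos {p q r : Fin N → ℤ}
    (h : posChain e p ⊆ enclos e (posChain e q ∪ posChain e r)) {i j : Fin N} (hij : i ≠ j) :
    gap p i j ≤ max (gap q i j) (gap r i j) := by
  have h1 := (h ⟨p j, rfl⟩).2 i j hij (unif F ^ max (gap q i j) (gap r i j)) ?_
  · rw [mem_halfApartment_posLattice, expo_self, expo_self, gap_self, add_zero, ord_unif_zpow] at h1
    exact h1
  · rintro _ (⟨k, rfl⟩ | ⟨k, rfl⟩)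
    · rw [mem_halfApartment_posLattice, ord_unif_zpow]
      exact (expo_le_add k i j).trans (add_le_add_left (le_max_left _ _) _)
    · rw [mem_halfApartment_posLattice, ord_unif_zpow]
      exact (expo_le_add k i j).trans (add_le_add_left (le_max_right _ _) _)

/-- The upper bound for the pair `(j, i)` becomes a lower bound for `(i, j)`, since opposite gaps
add up to 1. -/
theorem min_gap_le_of_subset_enclos {p q r : Fin N → ℤ} (hp : IsRegular p) (hq : IsRegular q)
    (hr : IsRegular r) (h : posChain e p ⊆ enclos e (posChain e q ∪ posChain e r)) (i j : Fin N)
    (hij : i ≠ j) : min (gap q i j) (gap r i j) ≤ gap p i j := by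
  have h1 := gap_le_max_of_subset_enclos e h hij.symm
  have h2 := gap_add_gap hp hij
  have h3 := gap_add_gap hq hij
  have h4 := gap_add_gap hr hij
  omega

/-- Adjacent chambers differ by a reflection. -/
theorem gap_eq_or_exists_isSucc {p q : Fin N → ℤ} (hp : IsRegular p) (hq : IsRegular q)
    (h : Adjacent (posChain e q) (posChain e p)) :
    gap q = gap p ∨ ∃ i j m, IsSucc p i j m ∧ gap q = gap (swapPos p i j) := by
  have hN : (0 : ℤ) < N := by exact_mod_cast NeZero.pos N
  obtain ⟨-, _, ⟨a, rfl⟩, ha⟩ := h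
  -- All lattices of `p` outside the single class of index `a` modulo `N` also belong to the chain
  -- of `q`, and therefore bound the gaps of `q` from below.
  have hle : ∀ k, (∀ m : ℤ, k ≠ a + m * N) → ∀ i j, expo p k i - expo p k j ≤ gap q i j := by
    intro k hk i j
    have h1 : posLattice e p k ∈ posChain e q := by
      by_contra hnot
      have h2 : posLattice e p k ∈ homothetyClass (posLattice e p a) := by
        rw [← ha]
        exact ⟨⟨k, rfl⟩, hnot⟩
      obtain ⟨c, hc⟩ := h2
      simp only [homothety_posLattice] at hc
      exact hk (ord c) ((posLattice_strictAnti e hp).injective hc).symm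
    obtain ⟨l, hl⟩ := h1
    rw [posLattice_eq_posLattice_iff] at hl
    have h2 := expo_le_add (pos := q) l i j
    rw [hl, hl] at h2
    omega
  have key : ∀ i j, gap q i j < gap p i j →
      (∃ m : ℤ, p j = a + m * N) ∧ IsSucc p i j (gap q i j) := by
    intro i j hij
    have hne : i ≠ j := by
      rintro rfl
      rw [gap_self, gap_self] at hij
      omega
    have hN1 : (1 : ℤ) < N := by
      have h1 : N ≠ 1 := by
        rintro rfl
        exact hne (Subsingleton.elim _ _)
      omega
    have h1 : ∃ m : ℤ, p j = a + m * N := by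
      by_contra! hcon
      have h2 := hle (p j) hcon i j
      rw [expo_self, expo_self, gap_self] at h2
      omega
    refine ⟨h1, hp, hne, ?_⟩
    obtain ⟨m, hm⟩ := h1
    -- The lattice of index `p j` is the missing one, so the one of index `p j - 1` is shared, as `N
    -- > 1`. It leaves room for a gap of `q` smaller than that of `p` only if a multiple of `e i`
    -- has position `p j - 1`.
    have h2 := hle (p j - 1) (fun n hn => by
      have h3 : (m - n) * (N : ℤ) = 1 := by rw [sub_mul]; linarith
      have h4 := Int.isUnit_iff.mp (IsUnit.of_mul_eq_one_right _ h3)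
      omega) i j
    have h3 : expo p (p j - 1) j = 0 := by
      rw [expo_eq_iff]
      omega
    rw [h3, sub_zero, expo_le_iff] at h2
    have h4 := gap_le_iff.not.mp (not_le.mpr hij)
    omega
  by_cases hqp : ∀ i j, gap p i j ≤ gap q i j
  · left
    funext i j
    by_cases hij : i = j
    · rw [hij, gap_self, gap_self]
    · have h1 := gap_add_gap hp hij
      have h2 := gap_add_gap hq hij
      have h3 := hqp i j
      have h4 := hqp j i
      omega
  · right
    push Not at hqp
    obtain ⟨i, j, hij⟩ := hqp
    obtain ⟨⟨m, hm⟩, hs⟩ := key i j hij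
    refine ⟨i, j, _, hs, ?_⟩
    -- The class of `a` determines `j`, and the predecessor of `e j` determines `i`. So a single gap
    -- decreases, the opposite one increases, and the others are squeezed by `gap_add_gap`.
    have huniq : ∀ a b, ¬ (a = i ∧ b = j) → gap p a b ≤ gap q a b := by
      intro a' b hab
      by_contra! hlt
      obtain ⟨⟨n, hn⟩, hs'⟩ := key a' b hlt
      have h1 : p b + m * N = p j + n * N := by linarith
      obtain ⟨rfl, -⟩ := hp.eq_of_eq h1
      have h2 : p a' + gap q a' b * N = p i + gap q i b * N := by linarith [hs.eq, hs'.eq]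
      exact hab ⟨(hp.eq_of_eq h2).1, rfl⟩
    funext x y
    by_cases hxy : x = y
    · rw [hxy, gap_self, gap_self]
    by_cases h1 : x = i ∧ y = j
    · obtain ⟨rfl, rfl⟩ := h1
      rw [hs.gap_swap_left_right]
    by_cases h2 : x = j ∧ y = i
    · obtain ⟨rfl, rfl⟩ := h2
      have := gap_add_gap hq hxy
      rw [hs.gap_swap_right_left]
      omega
    rw [hs.gap_swap_of_ne h1 h2]
    have h3 := huniq x y h1
    have h4 := huniq y x (by tauto)
    have h5 := gap_add_gap hp hxy
    have h6 := gap_add_gap hq hxy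
    omega

end Enclos

end IwahoriGL

end

/-! ### Assembly of the three assertions -/

theorem lemma8 {F : Type*} [Field F] [ValuativeRel F] [TopologicalSpace F]
    [IsNonarchimedeanLocalField F] {N : ℕ} (hN : 1 ≤ N)
    [MeasurableSpace (GL (Fin N) F)] [BorelSpace (GL (Fin N) F)]
    (μ : Measure (GL (Fin N) F)) [μ.IsHaarMeasure]
    (e : Module.Basis (Fin N) F (Fin N → F))
    (C_I : Set (Submodule 𝒪[F] (Fin N → F))) (hCI : IsChamber C_I) (hCIe : C_I ⊆ apartment e)
    (C_J : Set (Submodule 𝒪[F] (Fin N → F))) (hCJ : IsChamber C_J) (hCJe : C_J ⊆ apartment e)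
    {W : Type*} [AddCommGroup W] [Module ℂ W] (ρ : Representation ℂ (GL (Fin N) F) W)
    (hρ : IsSmooth ρ) :
    -- `v ↦ e_I · v` is a linear isomorphism from `W ^ J` onto `W ^ I`
    (∃ φ : fixedVectors ρ (iwahori C_J) ≃ₗ[ℂ] fixedVectors ρ (iwahori C_I),
      ∀ v, (φ v : W) = heckeAct μ ρ (idem μ (iwahori C_I)) v) ∧
    -- it factors through `W ^ K` for every chamber `C_K` in the enclos of `C_J ∪ C_I`
    (∀ C_K : Set (Submodule 𝒪[F] (Fin N → F)), IsChamber C_K → C_K ⊆ enclos e (C_J ∪ C_I) →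
      ∃ (α : fixedVectors ρ (iwahori C_J) →ₗ[ℂ] fixedVectors ρ (iwahori C_K))
        (β : fixedVectors ρ (iwahori C_K) →ₗ[ℂ] fixedVectors ρ (iwahori C_I)),
        (∀ v, (α v : W) = heckeAct μ ρ (idem μ (iwahori C_K)) v) ∧
        (∀ w, (β w : W) = heckeAct μ ρ (idem μ (iwahori C_I)) w) ∧
        ∀ v, (β (α v) : W) = heckeAct μ ρ (idem μ (iwahori C_I)) v) ∧
    -- the identities in the Hecke algebra for adjacent chambers
    (Adjacent C_I C_J → ∃ f g : GL (Fin N) F → ℂ, MemHecke f ∧ MemHecke g ∧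
      idem μ (iwahori C_J) =
        conv μ f (conv μ (idem μ (iwahori C_I)) (idem μ (iwahori C_J))) ∧
      idem μ (iwahori C_I) =
        conv μ (conv μ (idem μ (iwahori C_I)) (idem μ (iwahori C_J))) g) := by
  have : NeZero N := ⟨by omega⟩
  obtain ⟨q, hq, rfl⟩ := exists_eq_posChain e hCI hCIe
  obtain ⟨p, hp, rfl⟩ := exists_eq_posChain e hCJ hCJe
  rw [iwahori_posChain e hq, iwahori_posChain e hp]
  set b := frameMatrix e
  have hI := isCompactOpen_frameIwahori b q
  have hJ := isCompactOpen_frameIwahori b p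
  refine ⟨?_, fun C_K hCK hCKe => ?_, fun hadj => ?_⟩
  · have hbij := bijOn_heckeProj μ hρ b hq hp
    let φ : fixedVectors ρ (frameIwahori b p) →ₗ[ℂ] fixedVectors ρ (frameIwahori b q) :=
      (heckeProj μ hρ hI).restrict hbij.mapsTo
    exact ⟨LinearEquiv.ofBijective φ hbij.bijective, fun v => rfl⟩
  · obtain ⟨r, hr, rfl⟩ := exists_eq_posChain e hCK (hCKe.trans fun L hL => hL.1)
    rw [iwahori_posChain e hr]
    have hK := isCompactOpen_frameIwahori b r
    refine ⟨(heckeProj μ hρ hK).restrict fun v _ => heckeProj_mem μ hρ hK v,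
      (heckeProj μ hρ hI).restrict fun v _ => heckeProj_mem μ hρ hI v,
      fun v => rfl, fun w => rfl, fun v => ?_⟩
    refine heckeProj_heckeProj_of_factor μ hρ hI hK (exists_frame_factorization b hr ?_) v.2
    intro i j hij
    rw [min_comm]
    exact min_gap_le_of_subset_enclos e hr hp hq hCKe i j hij
  · obtain h | ⟨i, j, m, hs, h⟩ := gap_eq_or_exists_isSucc e hp hq hadj
    -- If the gaps agree, the two Iwahori subgroups coincide, and the idempotent itself serves as
    -- `f` and as `g`.
    · rw [frameIwahori_congr b h]
      refine ⟨_, _, memHecke_idem μ hJ, memHecke_idem μ hJ, ?_, ?_⟩ <;>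
        simp only [conv_idem_self μ hJ]
    · have h1 := isReflection_frame b hs
      -- The reverse exchange is a reflection too; it provides `g`, for which the roles of `I` and
      -- `J` are interchanged.
      have h2 := isReflection_frame b hs.symm
      rw [hs.swapPos_swapPos] at h2
      rw [← frameIwahori_congr b h] at h1 h2
      exact exists_conv_eq μ hI hJ h1 h2
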